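/- Let $\nu\ge 1$ and let $\mathcal A$ be the (unital) quasi-local $C^*$-algebra of a Haag–Kastler net $\mathcal O\mapsto\mathcal A(\mathcal O)$ over the bounded open subsets $\mathcal O$ of Minkowski space $\mathbb R^{1+\nu}$: the $\mathcal A(\mathcal O)$ are unital $C^*$-subalgebras of $\mathcal A$, increasing in $\mathcal O$, commuting for space-like separated regions, with norm-dense union, and the proper orthochronous Poincaré group acts on $\mathcal A$ by $*$-automorphisms $\alpha_g$ with $\alpha_g(\mathcal A(\mathcal O))=\mathcal A(g\mathcal O)$. Denote by $\tau_t$ ($t\in\mathbb R$) and $\sigma_{x}$ ($x\in\mathbb R^\nu$) the automorphisms of time and space translations and by $\lambda_v$ ($v\in\mathbb R$) those of the boosts $$(x^0,x^1,x^2,\dots,x^\nu)\mapsto(x^0\cosh v-x^1\sinh v,\;x^1\cosh v-x^0\sinh v,\;x^2,\dots,x^\nu).$$ Assume that $\|\tau_t(A)-A\|\to0$ as $t\to 0$, $\|\sigma_x(A)-A\|\to0$ as $x\to0$ and $\|\lambda_v(A)-A\|\to0$ as $v\to0$ for every $A\in\mathcal A$. Let $\omega$ be a state on $\mathcal A$ that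 is pure or a factor state (that is, the centre of $\pi_\omega(\mathcal A)''$ is trivial, $\pi_\omega$ being the GNS representation), is invariant under all space-time translations, and is extremal among the space-translation invariant states. Put $\omega_v=\omega\circ\lambda_v$. Then: (i) For every $v\in\mathbb R$, $\omega_v$ is an extremal space-translation invariant and time-translation invariant factor state. (ii) Let $f\in C^\infty(\mathbb R)$ be nonnegative, compactly supported, with $\int f(v)\,dv=1$, and let $\omega_f=\int f(v)\,\omega_v\,dv$. Then $\omega_f$ is a space-time translation invariant state, and it is not a factor state unless $\omega$ is invariant under all the boosts $\lambda_v$. Write $\omega_f$, $\sigma_x$, $\tau_t$ also for the canonical extensions to $\pi_{\omega_f}(\mathcal A)''$ (the vector state of the GNS vector, and conjugation by the unitaries that implement the translations and fix the GNS vector), and identify $A\in\mathcal A$ with $\pi_{\omega_f}(A)$. For every $B\in\mathcal A$ there is an element $B_f$ of the centre of $\pi_{\omega_f}(\mathcal A)''$, invariant under all space and time translations, such that for all $A\in\mathcal A$ (ii.a) $\omega_f(AB_f)=\omega_f(B_fA)$; (ii.b) $\lim_{|x|\to\infty}\omega_f\bigl(A\,\sigma_x(B-B_f)\bigr)=0$;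 (ii.c) $\lim_{t\to\infty}\omega_f\bigl(A\,\tau_t(B-B_f)\bigr)=0$. -/

import Mathlib

open Filter Topology MeasureTheory
open scoped ComplexOrder InnerProductSpace

noncomputable section

/-! ### Minkowski space and the Poincaré group -/

/-- Minkowski space-time with `ν` space dimensions; a point is `(t, x)`. -/
abbrev Spacetime (ν : ℕ) : Type := ℝ × EuclideanSpace ℝ (Fin ν)

namespace Spacetime

variable {ν : ℕ}

/-- The Minkowski square `t² - |x|²` (units with `c = 1`). -/
def minkowskiSq (p : Spacetime ν) : ℝ := p.1 ^ 2 - ‖p.2‖ ^ 2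

/-- The open forward light cone. -/
def forwardCone (ν : ℕ) : Set (Spacetime ν) := {p | ‖p.2‖ < p.1}

/-- Every point of `O₁` is space-like to every point of `O₂`. -/
def SpacelikeSeparated (O₁ O₂ : Set (Spacetime ν)) : Prop :=
  ∀ p ∈ O₁, ∀ q ∈ O₂, minkowskiSq (p - q) < 0

/-- The proper orthochronous Poincaré group: affine bijections whose linear part preserves the
Minkowski form, has determinant one and preserves the forward light cone. -/
def poincareGroup (ν : ℕ) : Subgroup (Spacetime ν ≃ᵃ[ℝ] Spacetime ν) where
  carrier := {g | (∀ p, minkowskiSq (g.linear p) = minkowskiSq p) ∧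
    (∀ p, g.linear p ∈ forwardCone ν ↔ p ∈ forwardCone ν) ∧
    LinearEquiv.det g.linear = 1}
  mul_mem' := by
    rintro g h ⟨g1, g2, g3⟩ ⟨h1, h2, h3⟩
    have e : (g * h).linear = g.linear * h.linear := rfl
    refine ⟨fun p => ?_, fun p => ?_, ?_⟩
    · rw [e, LinearEquiv.mul_apply, g1, h1]
    · rw [e, LinearEquiv.mul_apply, g2, h2]
    · rw [e, map_mul, g3, h3, one_mul]
  one_mem' := by
    have e : (1 : Spacetime ν ≃ᵃ[ℝ] Spacetime ν).linear = 1 := rfl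
    exact ⟨fun p => by rw [e]; rfl, fun p => by rw [e]; rfl, by rw [e, map_one]⟩
  inv_mem' := by
    rintro g ⟨g1, g2, g3⟩
    have e : (g⁻¹).linear = g.linear⁻¹ := rfl
    have k : ∀ p, g.linear (g.linear⁻¹ p) = p := fun p => g.linear.apply_symm_apply p
    refine ⟨fun p => ?_, fun p => ?_, ?_⟩
    · rw [e, ← g1, k]
    · rw [e, ← g2, k]
    · rw [e, map_inv, g3, inv_one]

/-- The translation `T(a) : p ↦ p + a` as an element of the Poincaré group. -/
def translation (a : Spacetime ν) : poincareGroup ν :=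
  ⟨AffineEquiv.constVAdd ℝ (Spacetime ν) a, by
    have e : (AffineEquiv.constVAdd ℝ (Spacetime ν) a).linear = 1 := rfl
    exact ⟨fun p => by rw [e]; rfl, fun p => by rw [e]; rfl, by rw [e, map_one]⟩⟩

variable [NeZero ν]

/-- The first spatial unit vector (index `0 : Fin ν`). -/
def e₁ : EuclideanSpace ℝ (Fin ν) := EuclideanSpace.single 0 1

/-- The velocity boost with rapidity `v` along the first axis:
`(t, x¹, x²,…) ↦ (t cosh v - x¹ sinh v, x¹ cosh v - t sinh v, x²,…)`. -/
def boostFun (v : ℝ) (p : Spacetime ν) : Spacetime ν :=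
  (p.1 * Real.cosh v - p.2 0 * Real.sinh v,
    p.2 + (p.2 0 * (Real.cosh v - 1) - p.1 * Real.sinh v) • e₁)

lemma boostFun_snd_zero (v : ℝ) (p : Spacetime ν) :
    (boostFun v p).2 0 = p.2 0 * Real.cosh v - p.1 * Real.sinh v := by
  simp [boostFun, e₁]; ring

lemma boostFun_snd_of_ne (v : ℝ) (p : Spacetime ν) {i : Fin ν} (hi : i ≠ 0) :
    (boostFun v p).2 i = p.2 i := by
  simp [boostFun, e₁, hi]

lemma boostFun_boostFun (v w : ℝ) (p : Spacetime ν) :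
    boostFun v (boostFun w p) = boostFun (v + w) p := by
  apply Prod.ext
  · change (boostFun w p).1 * Real.cosh v - (boostFun w p).2 0 * Real.sinh v = _
    rw [boostFun_snd_zero]
    simp only [boostFun, Real.cosh_add, Real.sinh_add]
    ring
  · ext i
    by_cases hi : i = 0
    · subst hi
      rw [boostFun_snd_zero, boostFun_snd_zero, boostFun_snd_zero]
      simp only [boostFun, Real.cosh_add, Real.sinh_add]
      ring
    · rw [boostFun_snd_of_ne _ _ hi, boostFun_snd_of_ne _ _ hi, boostFun_snd_of_ne _ _ hi]

lemma boostFun_zero (p : Spacetime ν) : boostFun 0 p = p := by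
  simp [boostFun]

/-- The boost as a linear automorphism of Minkowski space. -/
def boostLin (v : ℝ) : Spacetime ν ≃ₗ[ℝ] Spacetime ν where
  toFun := boostFun v
  invFun := boostFun (-v)
  left_inv p := by simp [boostFun_boostFun, boostFun_zero]
  right_inv p := by simp [boostFun_boostFun, boostFun_zero]
  map_add' p q := by
    apply Prod.ext
    · simp [boostFun]; ring
    · ext i; simp [boostFun]; ring
  map_smul' c p := by
    apply Prod.ext
    · simp [boostFun]; ring
    · ext i; simp [boostFun]; ring

lemma boostLin_mul (v w : ℝ) :
    (boostLin v * boostLin w : Spacetime ν ≃ₗ[ℝ] Spacetime ν) = boostLin (v + w) :=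
  LinearEquiv.ext fun p => boostFun_boostFun v w p

lemma boostLin_zero : (boostLin 0 : Spacetime ν ≃ₗ[ℝ] Spacetime ν) = 1 :=
  LinearEquiv.ext fun p => boostFun_zero p

/-- The reflection of the first spatial axis, used to compute the determinant of a boost. -/
def reflect : Spacetime ν ≃ₗ[ℝ] Spacetime ν :=
  LinearEquiv.ofInvolutive
    { toFun := fun p => (p.1, p.2 - (2 * p.2 0) • e₁)
      map_add' := fun p q => by
        apply Prod.ext
        · simp
        · ext i; simp; ring
      map_smul' := fun c p => by
        apply Prod.ext
        · simp
        · ext i; simp; ring }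
    (fun p => by
      apply Prod.ext
      · simp
      · ext i
        by_cases hi : i = 0
        · subst hi; simp [e₁]; ring
        · simp [e₁, hi])

lemma reflect_boost (v : ℝ) :
    (reflect * boostLin v * reflect⁻¹ : Spacetime ν ≃ₗ[ℝ] Spacetime ν) = boostLin (-v) := by
  rw [mul_inv_eq_iff_eq_mul]
  refine LinearEquiv.ext fun p => ?_
  apply Prod.ext
  · change (boostFun v p).1 = (boostFun (-v) (reflect p)).1
    simp [boostFun, reflect, e₁]; ring
  · change (boostFun v p).2 - (2 * (boostFun v p).2 0) • e₁ = (boostFun (-v) (reflect p)).2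
    ext i
    rw [boostFun_snd_zero]
    by_cases hi : i = 0
    · subst hi; simp [boostFun, reflect, e₁]; ring
    · simp [boostFun, reflect, e₁, hi]

lemma det_boostLin (v : ℝ) :
    LinearEquiv.det (boostLin v : Spacetime ν ≃ₗ[ℝ] Spacetime ν) = 1 := by
  have h1 : ∀ w : ℝ, LinearEquiv.det (boostLin w : Spacetime ν ≃ₗ[ℝ] Spacetime ν)
      * LinearEquiv.det (boostLin w : Spacetime ν ≃ₗ[ℝ] Spacetime ν) = 1 := by
    intro w
    have h := congrArg LinearEquiv.det (reflect_boost (ν := ν) w)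
    rw [map_mul, map_mul, map_inv, mul_inv_cancel_comm] at h
    nth_rewrite 2 [h]
    rw [← map_mul, boostLin_mul, add_neg_cancel, boostLin_zero, map_one]
  have h2 := h1 (v / 2)
  rwa [← map_mul, boostLin_mul, add_halves] at h2

lemma minkowskiSq_boost (v : ℝ) (p : Spacetime ν) :
    minkowskiSq (boostFun v p) = minkowskiSq p := by
  have h : ∀ (x : EuclideanSpace ℝ (Fin ν)) (c : ℝ),
      ‖x + c • e₁‖ ^ 2 = ‖x‖ ^ 2 + 2 * c * x 0 + c ^ 2 := by
    intro x c
    rw [norm_add_sq_real, norm_smul, inner_smul_right]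
    simp [e₁, EuclideanSpace.inner_single_right]
    ring
  unfold minkowskiSq
  simp only [boostFun]
  rw [h]
  linear_combination (p.1 ^ 2 - p.2 0 ^ 2) * Real.cosh_sq v

lemma forwardCone_boost_aux (v : ℝ) (p : Spacetime ν) (hp : p ∈ forwardCone ν) :
    boostFun v p ∈ forwardCone ν := by
  have hp' : ‖p.2‖ < p.1 := hp
  have hx : |p.2 0| ≤ ‖p.2‖ := by simpa using PiLp.norm_apply_le p.2 0
  have hsc : |Real.sinh v| < Real.cosh v := by
    rw [← abs_of_pos (Real.cosh_pos v)]
    apply sq_lt_sq.mp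
    nlinarith [Real.cosh_sq v]
  have ht : 0 < (boostFun v p).1 := by
    change 0 < p.1 * Real.cosh v - p.2 0 * Real.sinh v
    have h1 : p.2 0 * Real.sinh v ≤ ‖p.2‖ * |Real.sinh v| :=
      (le_abs_self _).trans (by rw [abs_mul]; gcongr)
    have h2 : ‖p.2‖ * |Real.sinh v| ≤ ‖p.2‖ * Real.cosh v := by gcongr
    have h3 : ‖p.2‖ * Real.cosh v < p.1 * Real.cosh v := by
      have := Real.cosh_pos v
      gcongr
    linarith
  have hq := minkowskiSq_boost v p
  unfold minkowskiSq at hq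
  change ‖(boostFun v p).2‖ < (boostFun v p).1
  apply lt_of_pow_lt_pow_left₀ 2 ht.le
  nlinarith [norm_nonneg p.2]

/-- The velocity boost `L(v)` as an element of the Poincaré group. -/
def boost (v : ℝ) : poincareGroup ν :=
  ⟨(boostLin v).toAffineEquiv, by
    have e : ((boostLin v : Spacetime ν ≃ₗ[ℝ] Spacetime ν).toAffineEquiv).linear
      = boostLin v := rfl
    refine ⟨fun p => ?_, fun p => ⟨fun h => ?_, fun h => ?_⟩, ?_⟩
    · rw [e]; exact minkowskiSq_boost v p
    · have := forwardCone_boost_aux (-v) _ h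
      rw [e] at this
      change boostFun (-v) (boostFun v p) ∈ _ at this
      simpa [boostFun_boostFun, boostFun_zero] using this
    · rw [e]; exact forwardCone_boost_aux v p h
    · rw [e]; exact det_boostLin v⟩

lemma boost_mul_boost (v w : ℝ) : (boost v * boost w : poincareGroup ν) = boost (v + w) :=
  Subtype.ext (AffineEquiv.ext fun p => boostFun_boostFun v w p)

lemma boost_zero : (boost 0 : poincareGroup ν) = 1 :=
  Subtype.ext (AffineEquiv.ext fun p => boostFun_zero p)

end Spacetime

/-! ### States, GNS representation, factors -/

section States

variable {A : Type*} [CStarAlgebra A] [PartialOrder A] [StarOrderedRing A]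

/-- A state: a normalised positive linear functional. -/
def IsState (ω : A →ₚ[ℂ] ℂ) : Prop := ω 1 = 1

/-- `ω` belongs to `S` and is not a nontrivial convex combination of elements of `S`. -/
def IsExtremalIn (S : Set (A →ₚ[ℂ] ℂ)) (ω : A →ₚ[ℂ] ℂ) : Prop :=
  ω ∈ S ∧ ∀ φ ∈ S, ∀ ψ ∈ S, ∀ s : ℝ, 0 < s → s < 1 →
    (∀ a, ω a = (s : ℂ) * φ a + ((1 - s : ℝ) : ℂ) * ψ a) → φ = ω ∧ ψ = ω

/-- A pure state: an extreme point of the set of all states. -/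
def IsPureState (ω : A →ₚ[ℂ] ℂ) : Prop := IsExtremalIn {φ | IsState φ} ω

/-- The pullback `ω ∘ γ` of a positive functional by a `*`-automorphism. -/
def pullback (ω : A →ₚ[ℂ] ℂ) (γ : A ≃⋆ₐ[ℂ] A) : A →ₚ[ℂ] ℂ :=
  PositiveLinearMap.mk₀
    { toFun := fun a => ω (γ a)
      map_add' := fun a b => by simp
      map_smul' := fun c a => by simp }
    (fun a ha => ω.map_nonneg (map_nonneg γ ha))

@[simp] lemma pullback_apply (ω : A →ₚ[ℂ] ℂ) (γ : A ≃⋆ₐ[ℂ] A) (a : A) :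
    pullback ω γ a = ω (γ a) := rfl

/-- The cyclic vector `Ω_ω` of the GNS representation, the class of `1`. -/
def gnsVector (ω : A →ₚ[ℂ] ℂ) : ω.GNS := ((ω.toPreGNS 1 : ω.PreGNS) : ω.GNS)

/-- The enveloping von Neumann algebra `π_ω(A)''` on the GNS Hilbert space. -/
def gnsVN (ω : A →ₚ[ℂ] ℂ) : VonNeumannAlgebra ω.GNS where
  toStarSubalgebra := StarSubalgebra.centralizer ℂ
    (StarSubalgebra.centralizer ℂ (Set.range ω.gnsStarAlgHom) : Set (ω.GNS →L[ℂ] ω.GNS))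
  centralizer_centralizer' := by simp

/-- The centre of the enveloping von Neumann algebra. -/
def gnsCenter (ω : A →ₚ[ℂ] ℂ) : Set (ω.GNS →L[ℂ] ω.GNS) :=
  {T | T ∈ gnsVN ω ∧ T ∈ (gnsVN ω).commutant}

/-- A factor (primary) state: the centre of `π_ω(A)''` consists of the scalars. -/
def IsFactorState (ω : A →ₚ[ℂ] ℂ) : Prop :=
  IsState ω ∧ ∀ T ∈ gnsCenter ω, ∃ c : ℂ, T = c • (1 : ω.GNS →L[ℂ] ω.GNS)

/-- The extension `T ↦ (Ω_ω, T Ω_ω)` of `ω` to bounded operators on the GNS space. -/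
def gnsExt (ω : A →ₚ[ℂ] ℂ) (T : ω.GNS →L[ℂ] ω.GNS) : ℂ := ⟪gnsVector ω, T (gnsVector ω)⟫_ℂ

lemma gnsExt_apply (ω : A →ₚ[ℂ] ℂ) (a : A) : gnsExt ω (ω.gnsStarAlgHom a) = ω a := by
  simp [gnsExt, gnsVector, PositiveLinearMap.preGNS_inner_def]

variable (ω : A →ₚ[ℂ] ℂ)

/-- `π(a)Ω ↦ π(γ a)Ω` on the pre-Hilbert space. -/
def preGnsIso (γ : A ≃⋆ₐ[ℂ] A) (h : ∀ a, ω (γ a) = ω a) : ω.PreGNS →L[ℂ] ω.PreGNS :=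
  LinearMap.mkContinuous
    { toFun := fun x => ω.toPreGNS (γ (ω.ofPreGNS x))
      map_add' := fun x y => by simp
      map_smul' := fun c x => by simp } 1 (fun x => by
        rw [PositiveLinearMap.preGNS_norm_def, PositiveLinearMap.preGNS_norm_def]
        simp [← map_star, ← map_mul, h])

lemma preGnsIso_apply (γ : A ≃⋆ₐ[ℂ] A) (h : ∀ a, ω (γ a) = ω a) (x : ω.PreGNS) :
    preGnsIso ω γ h x = ω.toPreGNS (γ (ω.ofPreGNS x)) := rfl

/-- The unitary on the GNS space with `U π(a)Ω = π(γ a)Ω`, for an automorphism `γ` leaving `ω`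
invariant. -/
def gnsUnitary (γ : A ≃⋆ₐ[ℂ] A) (h : ∀ a, ω (γ a) = ω a) :
    unitary (ω.GNS →L[ℂ] ω.GNS) :=
  ⟨(preGnsIso ω γ h).completion, by
    have h' : ∀ a, ω (γ.symm a) = ω a := fun a => by
      rw [← h (γ.symm a), StarAlgEquiv.apply_symm_apply]
    have hadj : star (preGnsIso ω γ h).completion = (preGnsIso ω γ.symm h').completion := by
      symm
      refine (ContinuousLinearMap.eq_adjoint_iff _ _).mpr fun x y => ?_
      induction x, y using UniformSpace.Completion.induction_on₂ with
      | hp => apply isClosed_eq <;> fun_prop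
      | ih x y =>
        simp only [ContinuousLinearMap.completion_apply_coe, UniformSpace.Completion.inner_coe,
          PositiveLinearMap.preGNS_inner_def, preGnsIso_apply,
          PositiveLinearMap.ofPreGNS_toPreGNS]
        rw [← h (star (γ.symm _) * _)]
        simp [map_star]
    rw [Unitary.mem_iff, hadj]
    constructor
    · ext x
      induction x using UniformSpace.Completion.induction_on with
      | hp => apply isClosed_eq <;> fun_prop
      | ih x => simp [preGnsIso_apply]
    · ext x
      induction x using UniformSpace.Completion.induction_on with
      | hp => apply isClosed_eq <;> fun_prop
      | ih x => simp [preGnsIso_apply]⟩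

/-- The extension `T ↦ U T U*` of an `ω`-preserving automorphism to operators on the GNS space. -/
def gnsAut (γ : A ≃⋆ₐ[ℂ] A) (h : ∀ a, ω (γ a) = ω a) :
    (ω.GNS →L[ℂ] ω.GNS) ≃⋆ₐ[ℂ] (ω.GNS →L[ℂ] ω.GNS) :=
  Unitary.conjStarAlgAut ℂ (ω.GNS →L[ℂ] ω.GNS) (gnsUnitary ω γ h)

lemma gnsUnitary_apply_coe (γ : A ≃⋆ₐ[ℂ] A) (h : ∀ a, ω (γ a) = ω a) (x : ω.PreGNS) :
    (gnsUnitary ω γ h : ω.GNS →L[ℂ] ω.GNS) (x : ω.GNS)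
      = (ω.toPreGNS (γ (ω.ofPreGNS x)) : ω.PreGNS) := by
  simp [gnsUnitary, preGnsIso_apply]

lemma gnsAut_gnsStarAlgHom (γ : A ≃⋆ₐ[ℂ] A) (h : ∀ a, ω (γ a) = ω a) (a : A) :
    gnsAut ω γ h (ω.gnsStarAlgHom a) = ω.gnsStarAlgHom (γ a) := by
  have key : (gnsUnitary ω γ h : ω.GNS →L[ℂ] ω.GNS) * ω.gnsStarAlgHom a
      = ω.gnsStarAlgHom (γ a) * (gnsUnitary ω γ h : ω.GNS →L[ℂ] ω.GNS) := by
    ext x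
    induction x using UniformSpace.Completion.induction_on with
    | hp => apply isClosed_eq <;> fun_prop
    | ih x => simp [gnsUnitary_apply_coe]
  rw [gnsAut, Unitary.conjStarAlgAut_apply, key, mul_assoc, Unitary.mul_star_self_of_mem
    (gnsUnitary ω γ h).2, mul_one]

end States

/-! ### Haag–Kastler nets -/

open Spacetime

/-- A Haag–Kastler net of local observable algebras, with quasi-local algebra `A`. Only the values
of `localAlg` on bounded open regions matter. -/
structure HaagKastlerNet (ν : ℕ) (A : Type*) [CStarAlgebra A] where
  /-- the local algebras -/
  localAlg : Set (Spacetime ν) → StarSubalgebra ℂ A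
  /-- local algebras are C*-algebras -/
  isClosed_localAlg : ∀ O, IsOpen O → Bornology.IsBounded O → IsClosed (localAlg O : Set A)
  /-- isotony -/
  isotony : ∀ O₁ O₂, IsOpen O₁ → Bornology.IsBounded O₁ → IsOpen O₂ → Bornology.IsBounded O₂ →
    O₁ ⊆ O₂ → localAlg O₁ ≤ localAlg O₂
  /-- local commutativity -/
  locality : ∀ O₁ O₂, IsOpen O₁ → Bornology.IsBounded O₁ → IsOpen O₂ → Bornology.IsBounded O₂ →
    SpacelikeSeparated O₁ O₂ → ∀ a ∈ localAlg O₁, ∀ b ∈ localAlg O₂, a * b = b * a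
  /-- `A` is generated in norm by the local algebras -/
  quasilocal : Dense {a : A | ∃ O, IsOpen O ∧ Bornology.IsBounded O ∧ a ∈ localAlg O}
  /-- the action of the Poincaré group by automorphisms -/
  act : poincareGroup ν →* (A ≃⋆ₐ[ℂ] A)
  /-- covariance -/
  covariance : ∀ (g : poincareGroup ν) (O), IsOpen O → Bornology.IsBounded O →
    (localAlg ((g : Spacetime ν ≃ᵃ[ℝ] Spacetime ν) '' O) : Set A) = act g '' (localAlg O : Set A)

/-- A smearing function: smooth, compactly supported, nonnegative and of integral one. -/
structure SmearingFunction where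
  /-- the underlying function -/
  toFun : ℝ → ℝ
  smooth : ContDiff ℝ ((⊤ : ℕ∞) : WithTop ℕ∞) toFun
  hasCompactSupport : HasCompactSupport toFun
  nonneg : ∀ v, 0 ≤ toFun v
  integral_eq_one : ∫ v, toFun v = 1

namespace HaagKastlerNet

variable {ν : ℕ} {A : Type*} [CStarAlgebra A]

/-- Space-time translations `ξ_a`. -/
def ξ (N : HaagKastlerNet ν A) (a : Spacetime ν) : A ≃⋆ₐ[ℂ] A := N.act (translation a)

/-- Time translations `τ_t`. -/
def τ (N : HaagKastlerNet ν A) (t : ℝ) : A ≃⋆ₐ[ℂ] A := N.ξ (t, 0)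

/-- Space translations `σ_x`. -/
def σ (N : HaagKastlerNet ν A) (x : EuclideanSpace ℝ (Fin ν)) : A ≃⋆ₐ[ℂ] A := N.ξ (0, x)

/-- Norm continuity of `t ↦ τ_t(a)` and `x ↦ σ_x(a)`. -/
def ContinuousTranslations (N : HaagKastlerNet ν A) : Prop :=
  (∀ a, Tendsto (fun t : ℝ => ‖N.τ t a - a‖) (𝓝 0) (𝓝 0)) ∧
  (∀ a, Tendsto (fun x : EuclideanSpace ℝ (Fin ν) => ‖N.σ x a - a‖) (𝓝 0) (𝓝 0))

section Boost

variable [NeZero ν]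

/-- The boost automorphisms `λ_v` along the first axis. -/
def boostAut (N : HaagKastlerNet ν A) (v : ℝ) : A ≃⋆ₐ[ℂ] A := N.act (boost v)

/-- Norm continuity of `v ↦ λ_v(a)`. -/
def ContinuousBoosts (N : HaagKastlerNet ν A) : Prop :=
  ∀ a, Tendsto (fun v : ℝ => ‖N.boostAut v a - a‖) (𝓝 0) (𝓝 0)

lemma boostAut_add (N : HaagKastlerNet ν A) (v w : ℝ) (a : A) :
    N.boostAut (v + w) a = N.boostAut v (N.boostAut w a) := by
  simp only [boostAut, ← boost_mul_boost, map_mul]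
  rfl

lemma ContinuousBoosts.continuous {N : HaagKastlerNet ν A} (h : N.ContinuousBoosts) (a : A) :
    Continuous fun v => N.boostAut v a := by
  rw [continuous_iff_continuousAt]
  intro v
  rw [ContinuousAt, tendsto_iff_norm_sub_tendsto_zero]
  have h1 : Tendsto (fun w : ℝ => w - v) (𝓝 v) (𝓝 0) := by
    have : Continuous fun w : ℝ => w - v := by fun_prop
    simpa using this.tendsto v
  refine ((h a).comp h1).congr fun w => ?_
  have e : N.boostAut w a = N.boostAut v (N.boostAut (w - v) a) := by
    rw [← boostAut_add]; congr 2; ring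
  rw [Function.comp_apply, e, ← map_sub]
  exact (NonUnitalStarAlgHom.norm_map (N.boostAut v) (N.boostAut v).injective _).symm

end Boost

variable [PartialOrder A] [StarOrderedRing A]

/-- Invariance under all space-time translations. -/
def IsTranslationInvariant (N : HaagKastlerNet ν A) (ω : A →ₚ[ℂ] ℂ) : Prop :=
  ∀ p a, ω (N.ξ p a) = ω a

/-- Invariance under time translations. -/
def IsTimeInvariant (N : HaagKastlerNet ν A) (ω : A →ₚ[ℂ] ℂ) : Prop :=
  ∀ t a, ω (N.τ t a) = ω a

/-- Invariance under space translations. -/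
def IsSpaceInvariant (N : HaagKastlerNet ν A) (ω : A →ₚ[ℂ] ℂ) : Prop :=
  ∀ x a, ω (N.σ x a) = ω a

/-- An extreme point of the set of space-translation invariant states. -/
def IsExtremalSpaceInvariant (N : HaagKastlerNet ν A) (ω : A →ₚ[ℂ] ℂ) : Prop :=
  IsExtremalIn {φ | IsState φ ∧ N.IsSpaceInvariant φ} ω

/-- The extension of `σ_x` to operators on the GNS space of a translation invariant state. -/
def σExt (N : HaagKastlerNet ν A) {ω : A →ₚ[ℂ] ℂ} (h : N.IsTranslationInvariant ω)
    (x : EuclideanSpace ℝ (Fin ν)) : (ω.GNS →L[ℂ] ω.GNS) ≃⋆ₐ[ℂ] (ω.GNS →L[ℂ] ω.GNS) :=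
  gnsAut ω (N.σ x) (h (0, x))

/-- The extension of `τ_t` to operators on the GNS space of a translation invariant state. -/
def τExt (N : HaagKastlerNet ν A) {ω : A →ₚ[ℂ] ℂ} (h : N.IsTranslationInvariant ω)
    (t : ℝ) : (ω.GNS →L[ℂ] ω.GNS) ≃⋆ₐ[ℂ] (ω.GNS →L[ℂ] ω.GNS) :=
  gnsAut ω (N.τ t) (h (t, 0))

variable [NeZero ν]

/-- The boosted functional `ω_v = ω ∘ λ_v`. -/
def boosted (N : HaagKastlerNet ν A) (ω : A →ₚ[ℂ] ℂ) (v : ℝ) : A →ₚ[ℂ] ℂ :=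
  pullback ω (N.boostAut v)

lemma integrable_smear {N : HaagKastlerNet ν A} (h : N.ContinuousBoosts) (ω : A →ₚ[ℂ] ℂ)
    (f : SmearingFunction) (a : A) :
    Integrable fun v : ℝ => (f.toFun v : ℂ) * N.boosted ω v a := by
  have hf : Continuous f.toFun := f.smooth.continuous
  have hω : Continuous fun v : ℝ => N.boosted ω v a :=
    (map_continuous ω).comp (h.continuous a)
  apply Continuous.integrable_of_hasCompactSupport
  · fun_prop
  · apply HasCompactSupport.mul_right
    exact f.hasCompactSupport.comp_left (g := fun r : ℝ => (r : ℂ)) Complex.ofReal_zero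

/-- The smeared functional `ω_f = ∫ f(v) ω_v dv`. -/
def smeared (N : HaagKastlerNet ν A) (h : N.ContinuousBoosts) (ω : A →ₚ[ℂ] ℂ)
    (f : SmearingFunction) : A →ₚ[ℂ] ℂ :=
  PositiveLinearMap.mk₀
    { toFun := fun a => ∫ v, (f.toFun v : ℂ) * N.boosted ω v a
      map_add' := fun a b => by
        simp only [map_add, mul_add]
        exact integral_add (integrable_smear h ω f a) (integrable_smear h ω f b)
      map_smul' := fun c a => by
        simp only [map_smul, smul_eq_mul, mul_left_comm _ c, RingHom.id_apply]
        exact integral_const_mul c _ }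
    (fun a ha => by
      refine integral_nonneg fun v => mul_nonneg ?_ ((N.boosted ω v).map_nonneg ha)
      exact Complex.zero_le_real.mpr (f.nonneg v))

end HaagKastlerNet

end

/-
An asymptotically central bounded family has its weak limit points in the centre, so in the GNS
representation of a factor state, and in particular of a pure one, it converges to scalars as soon
as its expectations converge. By locality this gives clustering at space-like infinity, and
extremality among the invariant states, for every translation invariant factor state; each `ω_v` is
one.

Weak limit points of `σ_x(B)` in the representation of `ω_f` yield a central `B_f` with
`ω_f(A B_f) = ∫ f(v) ω_v(A) ω_v(B) dv`. Clustering in time holds for the mixture `ω_f` although it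
may fail for each `ω_v`: for `v ≠ w` the boosted time translates `λ_v(τ_t(B))` and `λ_w(τ_t(B))`
separate in a space-like way, so the vectors `π_ω(λ_v(τ_t(B)) - ω_v(B)) Ω` form a bounded
asymptotically orthogonal family indexed by `v`, and integrals of such a family against integrable
functions tend to zero.

If `ω_f` is itself a factor state, clustering also gives `ω_f(A) ω_f(B)` as the limit, hence
`v ↦ ω_v(B)` has zero variance under `f(v) dv`. So `ω_v` is constant on the open set where
`f ≠ 0`, the stabilizer of `ω` in the one-parameter group of boosts is open, and it is all of `ℝ`.
-/

section GNS

variable {A : Type*} [CStarAlgebra A] [PartialOrder A] [StarOrderedRing A]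

/-- The class `π_ω(a) Ω_ω` of an element `a` in the GNS space, linear in `a`. Operators and
intertwiners on the GNS space are determined by their values on these dense vectors. -/
noncomputable def gnsClass (ω : A →ₚ[ℂ] ℂ) : A →ₗ[ℂ] ω.GNS where
  toFun a := ω.gnsStarAlgHom a (gnsVector ω)
  map_add' a b := by rw [map_add, add_apply]
  map_smul' c a := by rw [map_smul, smul_apply, RingHom.id_apply]

variable {ω φ : A →ₚ[ℂ] ℂ}

lemma gnsClass_apply (ω : A →ₚ[ℂ] ℂ) (a : A) :
    gnsClass ω a = ω.gnsStarAlgHom a (gnsVector ω) :=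
  rfl

lemma gnsClass_one (ω : A →ₚ[ℂ] ℂ) : gnsClass ω 1 = gnsVector ω := by
  rw [gnsClass_apply, map_one, one_apply_eq_self]

lemma gnsClass_eq_coe (ω : A →ₚ[ℂ] ℂ) (a : A) :
    gnsClass ω a = ((ω.toPreGNS a : ω.PreGNS) : ω.GNS) := by
  simp [gnsClass_apply, gnsVector]

lemma gnsStarAlgHom_gnsClass (ω : A →ₚ[ℂ] ℂ) (a b : A) :
    ω.gnsStarAlgHom a (gnsClass ω b) = gnsClass ω (a * b) := by
  rw [gnsClass_apply, gnsClass_apply, map_mul, mul_apply_eq_comp]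

lemma inner_gnsClass (ω : A →ₚ[ℂ] ℂ) (a b : A) :
    ⟪gnsClass ω a, gnsClass ω b⟫_ℂ = ω (star a * b) := by
  simp only [gnsClass_eq_coe, UniformSpace.Completion.inner_coe,
    PositiveLinearMap.preGNS_inner_def, PositiveLinearMap.ofPreGNS_toPreGNS]

lemma inner_gnsVector_gnsClass (ω : A →ₚ[ℂ] ℂ) (a : A) :
    ⟪gnsVector ω, gnsClass ω a⟫_ℂ = ω a := by
  rw [← gnsClass_one, inner_gnsClass, star_one, one_mul]

lemma norm_gnsClass_sq (ω : A →ₚ[ℂ] ℂ) (a : A) :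
    ‖gnsClass ω a‖ ^ 2 = (ω (star a * a)).re := by
  rw [← inner_gnsClass, inner_self_eq_norm_sq_to_K]
  norm_cast

lemma denseRange_gnsClass (ω : A →ₚ[ℂ] ℂ) : DenseRange (gnsClass ω) := by
  rw [show ⇑(gnsClass ω) = (fun x : ω.PreGNS => (x : ω.GNS)) ∘ ω.toPreGNS from
    funext (gnsClass_eq_coe ω)]
  exact UniformSpace.Completion.denseRange_coe.comp
    ω.toPreGNS.surjective.denseRange (UniformSpace.Completion.continuous_coe _)

lemma inner_gnsStarAlgHom_left (ω : A →ₚ[ℂ] ℂ) (a : A) (x y : ω.GNS) :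
    ⟪ω.gnsStarAlgHom a x, y⟫_ℂ = ⟪x, ω.gnsStarAlgHom (star a) y⟫_ℂ := by
  rw [map_star, ContinuousLinearMap.star_eq_adjoint, ContinuousLinearMap.adjoint_inner_right]

lemma gns_ext {E : Type*} [NormedAddCommGroup E] [NormedSpace ℂ E] {S T : ω.GNS →L[ℂ] E}
    (h : ∀ a, S (gnsClass ω a) = T (gnsClass ω a)) : S = T :=
  ContinuousLinearMap.coeFn_injective <|
    (denseRange_gnsClass ω).equalizer S.continuous T.continuous (funext h)

lemma gns_ext_inner {S T : ω.GNS →L[ℂ] ω.GNS}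
    (h : ∀ a b, ⟪gnsClass ω a, S (gnsClass ω b)⟫_ℂ = ⟪gnsClass ω a, T (gnsClass ω b)⟫_ℂ) :
    S = T := by
  refine gns_ext fun b => ext_inner_left ℂ fun x => ?_
  exact (denseRange_gnsClass ω).induction_on (p := fun x => ⟪x, S _⟫_ℂ = ⟪x, T _⟫_ℂ) x
    (isClosed_eq (by fun_prop) (by fun_prop)) fun a => h a b

lemma gnsExt_gnsStarAlgHom_mul (ω : A →ₚ[ℂ] ℂ) (a : A) (T : ω.GNS →L[ℂ] ω.GNS) :
    gnsExt ω (ω.gnsStarAlgHom a * T) = ⟪gnsClass ω (star a), T (gnsVector ω)⟫_ℂ := by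
  rw [gnsExt, mul_apply_eq_comp, gnsClass_apply, inner_gnsStarAlgHom_left, star_star]

lemma IsState.norm_gnsVector (h : IsState ω) : ‖gnsVector ω‖ = 1 := by
  rw [← pow_eq_one_iff_of_nonneg (norm_nonneg _) two_ne_zero, ← gnsClass_one, norm_gnsClass_sq,
    star_one, one_mul, h, Complex.one_re]

lemma norm_gnsStarAlgHom_le (ω : A →ₚ[ℂ] ℂ) (a : A) : ‖ω.gnsStarAlgHom a‖ ≤ ‖a‖ :=
  NonUnitalStarAlgHom.norm_apply_le ω.gnsStarAlgHom a

lemma IsState.norm_gnsClass_le (h : IsState ω) (a : A) : ‖gnsClass ω a‖ ≤ ‖a‖ :=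
  calc ‖gnsClass ω a‖ ≤ ‖ω.gnsStarAlgHom a‖ * ‖gnsVector ω‖ := (ω.gnsStarAlgHom a).le_opNorm _
    _ ≤ ‖a‖ := by rw [h.norm_gnsVector, mul_one]; exact norm_gnsStarAlgHom_le ω a

lemma IsState.norm_apply_le (h : IsState ω) (a : A) : ‖ω a‖ ≤ ‖a‖ :=
  calc ‖ω a‖ = ‖⟪gnsVector ω, gnsClass ω a⟫_ℂ‖ := by rw [inner_gnsVector_gnsClass]
    _ ≤ ‖gnsVector ω‖ * ‖gnsClass ω a‖ := norm_inner_le_norm _ _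
    _ ≤ ‖a‖ := by rw [h.norm_gnsVector, one_mul]; exact h.norm_gnsClass_le a

lemma exists_eq_inner_of_dominated {C : ℝ}
    (h : ∀ a, (φ (star a * a)).re ≤ C * (ω (star a * a)).re) :
    ∃ ξ : ω.GNS, ∀ a, φ a = ⟪ξ, gnsClass ω a⟫_ℂ := by
  have hbound : ∀ a, ‖φ a‖ ≤ (‖gnsVector φ‖ * √C) * ‖gnsClass ω a‖ := fun a =>
    calc ‖φ a‖ = ‖⟪gnsVector φ, gnsClass φ a⟫_ℂ‖ := by rw [inner_gnsVector_gnsClass]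
      _ ≤ ‖gnsVector φ‖ * ‖gnsClass φ a‖ := norm_inner_le_norm _ _
      _ ≤ ‖gnsVector φ‖ * (√C * ‖gnsClass ω a‖) := by
        gcongr
        rw [← Real.sqrt_sq (norm_nonneg (gnsClass ω a)), ← Real.sqrt_mul' C (sq_nonneg _)]
        exact Real.le_sqrt_of_sq_le (by simpa only [norm_gnsClass_sq] using h a)
      _ = _ := (mul_assoc _ _ _).symm
  let F := (φ : A →ₗ[ℂ] ℂ).extendOfNorm (gnsClass ω)
  refine ⟨(InnerProductSpace.toDual ℂ ω.GNS).symm F, fun a => ?_⟩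
  rw [InnerProductSpace.toDual_symm_apply]
  exact (LinearMap.extendOfNorm_eq (denseRange_gnsClass ω) ⟨_, hbound⟩ a).symm

lemma gnsStarAlgHom_mem_gnsVN (ω : A →ₚ[ℂ] ℂ) (a : A) : ω.gnsStarAlgHom a ∈ gnsVN ω :=
  (StarSubalgebra.mem_centralizer_iff ℂ).2 fun _ hS =>
    ⟨((StarSubalgebra.mem_centralizer_iff ℂ).1 hS _ ⟨a, rfl⟩).1.symm,
      ((StarSubalgebra.mem_centralizer_iff ℂ).1 (star_mem hS) _ ⟨a, rfl⟩).1.symm⟩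

lemma mem_commutant_gnsVN_iff {T : ω.GNS →L[ℂ] ω.GNS} :
    T ∈ (gnsVN ω).commutant ↔ ∀ a, Commute T (ω.gnsStarAlgHom a) := by
  rw [VonNeumannAlgebra.mem_commutant_iff]
  refine ⟨fun h a => (h _ (gnsStarAlgHom_mem_gnsVN ω a)).symm, fun h S hS => ?_⟩
  have hT : T ∈ StarSubalgebra.centralizer ℂ (Set.range ω.gnsStarAlgHom) := by
    rw [StarSubalgebra.mem_centralizer_iff, Set.forall_mem_range]
    intro a
    rw [← map_star]
    exact ⟨(h a).eq.symm, (h (star a)).eq.symm⟩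
  exact ((StarSubalgebra.mem_centralizer_iff ℂ).1 hS T hT).1.symm

lemma mem_gnsCenter_iff {T : ω.GNS →L[ℂ] ω.GNS} :
    T ∈ gnsCenter ω ↔ (∀ S ∈ (gnsVN ω).commutant, Commute S T) ∧
      ∀ a, Commute T (ω.gnsStarAlgHom a) := by
  change T ∈ gnsVN ω ∧ T ∈ (gnsVN ω).commutant ↔ _
  rw [mem_commutant_gnsVN_iff, ← VonNeumannAlgebra.commutant_commutant (gnsVN ω),
    VonNeumannAlgebra.mem_commutant_iff, VonNeumannAlgebra.commutant_commutant]
  rfl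

end GNS

section Factor

variable {A : Type*} [CStarAlgebra A] [PartialOrder A] [StarOrderedRing A] {ω φ : A →ₚ[ℂ] ℂ}

lemma map_mem_gnsCenter {γ : A ≃⋆ₐ[ℂ] A}
    (Φ : (φ.GNS →L[ℂ] φ.GNS) ≃⋆ₐ[ℂ] (ω.GNS →L[ℂ] ω.GNS))
    (hΦ : ∀ a, Φ (φ.gnsStarAlgHom a) = ω.gnsStarAlgHom (γ a)) {T : φ.GNS →L[ℂ] φ.GNS}
    (hT : T ∈ gnsCenter φ) : Φ T ∈ gnsCenter ω := by
  have hΦ_symm : ∀ a, Φ.symm (ω.gnsStarAlgHom (γ a)) = φ.gnsStarAlgHom a := fun a => by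
    rw [← hΦ, StarAlgEquiv.symm_apply_apply]
  rw [mem_gnsCenter_iff] at hT ⊢
  refine ⟨fun S hS => ?_, fun a => ?_⟩
  · have hS' : Φ.symm S ∈ (gnsVN φ).commutant := mem_commutant_gnsVN_iff.2 fun a => by
      rw [← hΦ_symm]
      exact (mem_commutant_gnsVN_iff.1 hS (γ a)).map Φ.symm
    simpa only [StarAlgEquiv.apply_symm_apply] using (hT.1 _ hS').map Φ
  · rw [← γ.apply_symm_apply a, ← hΦ]
    exact (hT.2 _).map Φ

/-- The identification `π_{ω ∘ γ}(a) Ω ↦ π_ω(γ a) Ω` of the GNS space of `ω ∘ γ` with that of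
`ω`. It intertwines the representations `π_{ω ∘ γ}` and `π_ω ∘ γ`. -/
noncomputable def gnsPullbackEquiv (ω : A →ₚ[ℂ] ℂ) (γ : A ≃⋆ₐ[ℂ] A) :
    (pullback ω γ).GNS ≃ₗᵢ[ℂ] ω.GNS :=
  γ.toAlgEquiv.toLinearEquiv.extendOfIsometry (gnsClass (pullback ω γ)) (gnsClass ω)
    (denseRange_gnsClass _) (denseRange_gnsClass _) fun a => by
      rw [← sq_eq_sq₀ (norm_nonneg _) (norm_nonneg _), norm_gnsClass_sq, norm_gnsClass_sq,
        pullback_apply, map_mul γ, map_star γ]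
      rfl

lemma gnsPullbackEquiv_gnsClass (ω : A →ₚ[ℂ] ℂ) (γ : A ≃⋆ₐ[ℂ] A) (a : A) :
    gnsPullbackEquiv ω γ (gnsClass (pullback ω γ) a) = gnsClass ω (γ a) :=
  LinearEquiv.extendOfIsometry_eq _ _ _ _ _ _ a

lemma gnsPullbackEquiv_conj_gnsStarAlgHom (ω : A →ₚ[ℂ] ℂ) (γ : A ≃⋆ₐ[ℂ] A) (a : A) :
    (gnsPullbackEquiv ω γ).conjStarAlgEquiv ((pullback ω γ).gnsStarAlgHom a) =
      ω.gnsStarAlgHom (γ a) := by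
  refine gns_ext fun b => ?_
  rw [← γ.apply_symm_apply b, LinearIsometryEquiv.conjStarAlgEquiv_apply_apply,
    ← gnsPullbackEquiv_gnsClass, LinearIsometryEquiv.symm_apply_apply, gnsStarAlgHom_gnsClass,
    gnsPullbackEquiv_gnsClass, gnsPullbackEquiv_gnsClass, gnsStarAlgHom_gnsClass, map_mul]

lemma IsFactorState.pullback (hω : IsFactorState ω) (γ : A ≃⋆ₐ[ℂ] A) :
    IsFactorState (pullback ω γ) := by
  refine ⟨by rw [IsState, pullback_apply, map_one, hω.1], fun T hT => ?_⟩
  set Φ := (gnsPullbackEquiv ω γ).conjStarAlgEquiv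
  obtain ⟨c, hc⟩ := hω.2 _ (map_mem_gnsCenter Φ (gnsPullbackEquiv_conj_gnsStarAlgHom ω γ) hT)
  have hc' : Φ.toAlgEquiv (c • 1) = c • 1 := by
    rw [← Algebra.algebraMap_eq_smul_one, AlgEquiv.commutes, Algebra.algebraMap_eq_smul_one]
  exact ⟨c, Φ.toAlgEquiv.injective (hc.trans hc'.symm)⟩

lemma inner_map_gnsClass {S : ω.GNS →L[ℂ] ω.GNS} (hS : S ∈ (gnsVN ω).commutant) (a b : A) :
    ⟪gnsClass ω a, S (gnsClass ω b)⟫_ℂ = ⟪gnsVector ω, S (gnsClass ω (star a * b))⟫_ℂ := by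
  have hcomm := (mem_commutant_gnsVN_iff.1 hS (star a)).eq
  rw [gnsClass_apply ω a, inner_gnsStarAlgHom_left, ← mul_apply_eq_comp, ← hcomm,
    mul_apply_eq_comp, gnsStarAlgHom_gnsClass]

/-- The positive functional `a ↦ ⟪Ω, S π_ω(a) Ω⟫` attached to a positive operator `S` in the
commutant of `π_ω(A)`. A convex decomposition of `1` into such operators gives one of `ω`, which is
how purity constrains the commutant. -/
noncomputable def commutantFunctional (ω : A →ₚ[ℂ] ℂ) (S : ω.GNS →L[ℂ] ω.GNS)
    (hS : S ∈ (gnsVN ω).commutant) (hpos : S.IsPositive) : A →ₚ[ℂ] ℂ :=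
  PositiveLinearMap.mk₀ ((innerSL ℂ (gnsVector ω) ∘L S).toLinearMap ∘ₗ gnsClass ω) fun a ha => by
    obtain ⟨b, rfl⟩ := CStarAlgebra.nonneg_iff_eq_star_mul_self.1 ha
    rw [LinearMap.comp_apply]
    change 0 ≤ ⟪gnsVector ω, S (gnsClass ω (star b * b))⟫_ℂ
    rw [← inner_map_gnsClass hS]
    exact hpos.inner_nonneg_right _

lemma commutantFunctional_apply {S : ω.GNS →L[ℂ] ω.GNS} (hS : S ∈ (gnsVN ω).commutant)
    (hpos : S.IsPositive) (a : A) :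
    commutantFunctional ω S hS hpos a = ⟪gnsVector ω, S (gnsClass ω a)⟫_ℂ :=
  rfl

lemma IsState.gnsExt_one (h : IsState ω) : gnsExt ω 1 = 1 := by
  rw [← map_one ω.gnsStarAlgHom, gnsExt_apply, h]

lemma gnsExt_add (S T : ω.GNS →L[ℂ] ω.GNS) : gnsExt ω (S + T) = gnsExt ω S + gnsExt ω T :=
  inner_add_right _ _ _

lemma gnsExt_smul (c : ℂ) (T : ω.GNS →L[ℂ] ω.GNS) : gnsExt ω (c • T) = c * gnsExt ω T :=
  inner_smul_right _ _ _

lemma smul_mem_commutant_gnsVN (c : ℂ) {T : ω.GNS →L[ℂ] ω.GNS} (hT : T ∈ (gnsVN ω).commutant) :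
    c • T ∈ (gnsVN ω).commutant :=
  mem_commutant_gnsVN_iff.2 fun a => (mem_commutant_gnsVN_iff.1 hT a).smul_left c

lemma IsPureState.eq_zero_of_isPositive (hω : IsPureState ω) {T : ω.GNS →L[ℂ] ω.GNS}
    (hT : T ∈ (gnsVN ω).commutant) (hadd : (1 + T).IsPositive) (hsub : (1 + -T).IsPositive)
    (hT_zero : gnsExt ω T = 0) : T = 0 := by
  have hS : 1 + T ∈ (gnsVN ω).commutant := add_mem (one_mem _) hT
  have hS' : 1 + -T ∈ (gnsVN ω).commutant := add_mem (one_mem _) (neg_mem hT)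
  have hdecomp : ∀ a, ω a = ((1 / 2 : ℝ) : ℂ) * commutantFunctional ω (1 + T) hS hadd a +
      ((1 - 1 / 2 : ℝ) : ℂ) * commutantFunctional ω (1 + -T) hS' hsub a := fun a => by
    rw [commutantFunctional_apply, commutantFunctional_apply, ← inner_gnsVector_gnsClass]
    simp only [add_apply, neg_apply, one_apply_eq_self, inner_add_right, inner_neg_right]
    push_cast
    ring
  have hstate : ∀ (S : ω.GNS →L[ℂ] ω.GNS) (hS : 1 + S ∈ (gnsVN ω).commutant) (hpos),
      gnsExt ω S = 0 → IsState (commutantFunctional ω (1 + S) hS hpos) :=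
    fun S hS hpos hzero => by
      have hone : gnsExt ω (1 + S) = 1 := by
        rw [gnsExt_add, IsState.gnsExt_one hω.1, hzero, add_zero]
      rwa [IsState, commutantFunctional_apply, gnsClass_one]
  have hT_zero' : gnsExt ω (-T) = 0 := by rw [← neg_one_smul ℂ T, gnsExt_smul, hT_zero, mul_zero]
  have hφ := (hω.2 _ (hstate T hS hadd hT_zero) _ (hstate _ hS' hsub hT_zero') (1 / 2)
    (by norm_num) (by norm_num) hdecomp).1
  have hS_one : 1 + T = 1 := gns_ext_inner fun a b => by
    rw [inner_map_gnsClass hS, ← commutantFunctional_apply hS hadd, hφ, one_apply_eq_self,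
      inner_gnsClass]
  exact add_eq_left.1 hS_one

lemma isPositive_one_add {𝕜 H : Type*} [RCLike 𝕜] [NormedAddCommGroup H]
    [InnerProductSpace 𝕜 H] {T : H →L[𝕜] H} (hT : T.IsSymmetric) (hle : ‖T‖ ≤ 1) :
    (1 + T).IsPositive := by
  refine ⟨LinearMap.IsSymmetric.id.add hT, fun x => ?_⟩
  have hTx : ‖⟪T x, x⟫_𝕜‖ ≤ ‖x‖ ^ 2 :=
    calc ‖⟪T x, x⟫_𝕜‖ ≤ ‖T x‖ * ‖x‖ := norm_inner_le_norm _ _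
      _ ≤ (1 * ‖x‖) * ‖x‖ := by gcongr; exact T.le_of_opNorm_le hle x
      _ = ‖x‖ ^ 2 := by ring
  change 0 ≤ RCLike.re ⟪x + T x, x⟫_𝕜
  rw [inner_add_left, map_add, inner_self_eq_norm_sq]
  linarith [neg_abs_le (RCLike.re ⟪T x, x⟫_𝕜), RCLike.abs_re_le_norm ⟪T x, x⟫_𝕜]

lemma IsPureState.eq_zero_of_isSymmetric (hω : IsPureState ω) {T : ω.GNS →L[ℂ] ω.GNS}
    (hT : T ∈ (gnsVN ω).commutant) (hsymm : T.IsSymmetric) (hT_zero : gnsExt ω T = 0) :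
    T = 0 := by
  set ε : ℝ := (‖T‖ + 1)⁻¹
  have hε : 0 < ε := by positivity
  have hsymm' : ((ε : ℂ) • T).IsSymmetric := hsymm.smul (Complex.conj_ofReal ε)
  have hsymm_neg : (-((ε : ℂ) • T)).IsSymmetric := fun x y => by
    simpa only [ContinuousLinearMap.toLinearMap_neg, LinearMap.neg_apply, inner_neg_left,
      inner_neg_right, neg_inj] using hsymm' x y
  have hle : ‖(ε : ℂ) • T‖ ≤ 1 := by
    rw [norm_smul, Complex.norm_real, Real.norm_of_nonneg hε.le, inv_mul_le_one₀ (by positivity)]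
    exact (lt_add_one _).le
  have hzero : (ε : ℂ) • T = 0 :=
    hω.eq_zero_of_isPositive (smul_mem_commutant_gnsVN _ hT) (isPositive_one_add hsymm' hle)
      (isPositive_one_add hsymm_neg (by rwa [norm_neg]))
      (by rw [gnsExt_smul, hT_zero, mul_zero])
  exact (smul_eq_zero.1 hzero).resolve_left (Complex.ofReal_ne_zero.2 hε.ne')

lemma IsPureState.eq_gnsExt_smul_one_of_isSymmetric (hω : IsPureState ω) {T : ω.GNS →L[ℂ] ω.GNS}
    (hT : T ∈ (gnsVN ω).commutant) (hsymm : T.IsSymmetric) : T = gnsExt ω T • 1 := by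
  have hreal : (starRingEnd ℂ) (-gnsExt ω T) = -gnsExt ω T := by
    rw [map_neg, gnsExt, inner_conj_symm, neg_inj]
    exact hsymm _ _
  have hzero := hω.eq_zero_of_isSymmetric (T := T + (-gnsExt ω T) • 1)
    (add_mem hT (smul_mem_commutant_gnsVN _ (one_mem _)))
    (hsymm.add (LinearMap.IsSymmetric.id.smul hreal))
    (by rw [gnsExt_add, gnsExt_smul, IsState.gnsExt_one hω.1, mul_one, add_neg_cancel])
  rwa [neg_smul, ← sub_eq_add_neg, sub_eq_zero] at hzero

lemma IsPureState.isFactorState (hω : IsPureState ω) : IsFactorState ω := by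
  refine ⟨hω.1, fun T hT => ?_⟩
  have hT_comm : T ∈ (gnsVN ω).commutant := hT.2
  have hadd : (T + star T).IsSymmetric := (IsSelfAdjoint.add_star_self T).isSymmetric
  have hsub : (Complex.I • (T - star T)).IsSymmetric := by
    rw [← ContinuousLinearMap.isSelfAdjoint_iff_isSymmetric,
      IsSelfAdjoint, star_smul, star_sub, star_star,
      RCLike.star_def, Complex.conj_I, neg_smul, ← smul_neg, neg_sub]
  have hre := hω.eq_gnsExt_smul_one_of_isSymmetric (add_mem hT_comm (star_mem hT_comm)) hadd
  have him := hω.eq_gnsExt_smul_one_of_isSymmetric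
    (smul_mem_commutant_gnsVN _ (sub_mem hT_comm (star_mem hT_comm))) hsub
  generalize gnsExt ω (T + star T) = x at hre
  generalize gnsExt ω (Complex.I • (T - star T)) = y at him
  have hparts : T = (1 / 2 : ℂ) • ((T + star T) - Complex.I • Complex.I • (T - star T)) := by
    rw [smul_smul, Complex.I_mul_I]
    module
  refine ⟨1 / 2 * (x - Complex.I * y), ?_⟩
  rw [hparts, hre, him]
  module

end Factor

section WeakLimits

lemma exists_tendsto_inner_of_norm_le {𝕜 H ι : Type*} [RCLike 𝕜] [NormedAddCommGroup H]
    [InnerProductSpace 𝕜 H] [CompleteSpace H] (U : Ultrafilter ι) {T : ι → H →L[𝕜] H} {C : ℝ}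
    (hC : ∀ i, ‖T i‖ ≤ C) :
    ∃ S : H →L[𝕜] H, ∀ x y, Tendsto (fun i => ⟪x, T i y⟫_𝕜) U (𝓝 ⟪x, S y⟫_𝕜) := by
  have hbd : ∀ x y i, ‖⟪T i x, y⟫_𝕜‖ ≤ C * ‖x‖ * ‖y‖ := fun x y i =>
    (norm_inner_le_norm _ _).trans (by gcongr; exact (T i).le_of_opNorm_le (hC i) x)
  have hlim : ∀ x y, ∃ z : 𝕜, ‖z‖ ≤ C * ‖x‖ * ‖y‖ ∧
      Tendsto (fun i => ⟪T i x, y⟫_𝕜) U (𝓝 z) := fun x y => by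
    obtain ⟨z, hz, hU⟩ := (isCompact_closedBall (0 : 𝕜) (C * ‖x‖ * ‖y‖)).ultrafilter_le_nhds
      (U.map fun i => ⟪T i x, y⟫_𝕜) (le_principal_iff.2 <| Ultrafilter.mem_map.2 <|
        Eventually.of_forall fun i => mem_closedBall_zero_iff.2 (hbd x y i))
    exact ⟨z, mem_closedBall_zero_iff.1 hz, hU⟩
  choose F hF hFlim using hlim
  let B : H →L⋆[𝕜] H →L[𝕜] 𝕜 := LinearMap.mkContinuous₂
    (LinearMap.mk₂'ₛₗ (starRingEnd 𝕜) (RingHom.id 𝕜) F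
      (fun x x' y => tendsto_nhds_unique (hFlim _ _) (by
        simpa only [map_add, inner_add_left] using (hFlim x y).add (hFlim x' y)))
      (fun c x y => tendsto_nhds_unique (hFlim _ _) (by
        simpa only [map_smul, inner_smul_left, smul_eq_mul] using (hFlim x y).const_mul _))
      (fun x y y' => tendsto_nhds_unique (hFlim _ _) (by
        simpa only [inner_add_right] using (hFlim x y).add (hFlim x y')))
      (fun c x y => tendsto_nhds_unique (hFlim _ _) (by
        simpa only [inner_smul_right, smul_eq_mul, RingHom.id_apply] using
          (hFlim x y).const_mul _))) C hF
  refine ⟨InnerProductSpace.continuousLinearMapOfBilin B, fun x y => ?_⟩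
  rw [← inner_conj_symm, InnerProductSpace.continuousLinearMapOfBilin_apply]
  refine ((RCLike.continuous_conj.tendsto _).comp (hFlim y x)).congr fun i => ?_
  rw [Function.comp_apply, inner_conj_symm]

end WeakLimits

section AsymptoticallyCentral

/-- The family `b` is asymptotically central along `l`: its commutators with every fixed element
tend to zero. Weak limit points of `π_ω(b i)` are then central. -/
def IsAsymptoticallyCentral {A ι : Type*} [Ring A] [TopologicalSpace A] (b : ι → A)
    (l : Filter ι) : Prop :=
  ∀ a, Tendsto (fun i => a * b i - b i * a) l (𝓝 0)

lemma IsAsymptoticallyCentral.mono {A ι : Type*} [Ring A] [TopologicalSpace A] {b : ι → A}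
    {l l' : Filter ι} (hb : IsAsymptoticallyCentral b l) (h : l' ≤ l) :
    IsAsymptoticallyCentral b l' :=
  fun a => (hb a).mono_left h

variable {A ι : Type*} [CStarAlgebra A] [PartialOrder A] [StarOrderedRing A]
  {ω φ : A →ₚ[ℂ] ℂ} {b : ι → A} {l : Filter ι}

lemma IsAsymptoticallyCentral.mem_gnsCenter_of_tendsto [l.NeBot]
    (hb : IsAsymptoticallyCentral b l) {T : ω.GNS →L[ℂ] ω.GNS}
    (hT : ∀ x y, Tendsto (fun i => ⟪x, ω.gnsStarAlgHom (b i) y⟫_ℂ) l (𝓝 ⟪x, T y⟫_ℂ)) :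
    T ∈ gnsCenter ω := by
  have hTS : ∀ S : ω.GNS →L[ℂ] ω.GNS, ∀ x y,
      Tendsto (fun i => ⟪x, (S * ω.gnsStarAlgHom (b i)) y⟫_ℂ) l (𝓝 ⟪x, (S * T) y⟫_ℂ) :=
    fun S x y => by
      simpa only [ContinuousLinearMap.adjoint_inner_left, mul_apply_eq_comp] using
        hT (ContinuousLinearMap.adjoint S x) y
  refine mem_gnsCenter_iff.2 ⟨fun S hS => ?_, fun a => ?_⟩
  · refine ContinuousLinearMap.ext fun y => ext_inner_left ℂ fun x => ?_
    refine tendsto_nhds_unique (hTS S x y) ((hT x (S y)).congr fun i => ?_)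
    rw [(mem_commutant_gnsVN_iff.1 hS (b i)).eq, mul_apply_eq_comp]
  · refine ContinuousLinearMap.ext fun y => ext_inner_left ℂ fun x => ?_
    have hzero : Tendsto (fun i => ⟪x, ω.gnsStarAlgHom (a * b i - b i * a) y⟫_ℂ) l (𝓝 0) := by
      have hcont : Continuous fun c => ⟪x, ω.gnsStarAlgHom c y⟫_ℂ := by
        have := map_continuous ω.gnsStarAlgHom
        fun_prop
      have h := (hcont.tendsto 0).comp (hb a)
      simpa only [Function.comp_def, map_zero, zero_apply, inner_zero_right] using h
    refine (sub_eq_zero.1 (tendsto_nhds_unique ?_ hzero)).symm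
    refine ((hTS (ω.gnsStarAlgHom a) x y).sub (hT x (ω.gnsStarAlgHom a y))).congr fun i => ?_
    rw [map_sub, map_mul, map_mul, sub_apply, inner_sub_right,
      mul_apply_eq_comp (ω.gnsStarAlgHom (b i))]

lemma IsFactorState.tendsto_inner (hω : IsFactorState ω) (hb : IsAsymptoticallyCentral b l)
    {C : ℝ} (hC : ∀ i, ‖b i‖ ≤ C) {m : ℂ} (hm : Tendsto (fun i => ω (b i)) l (𝓝 m))
    (x y : ω.GNS) :
    Tendsto (fun i => ⟪x, ω.gnsStarAlgHom (b i) y⟫_ℂ) l (𝓝 (m * ⟪x, y⟫_ℂ)) := by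
  rw [tendsto_iff_ultrafilter]
  intro U hU
  obtain ⟨T, hT⟩ := exists_tendsto_inner_of_norm_le U fun i =>
    (norm_gnsStarAlgHom_le ω (b i)).trans (hC i)
  obtain ⟨c, rfl⟩ := hω.2 T ((hb.mono hU).mem_gnsCenter_of_tendsto hT)
  have hc : c = m := by
    refine tendsto_nhds_unique ?_ (hm.mono_left hU)
    refine ((hT (gnsVector ω) (gnsVector ω)).congr fun i => gnsExt_apply ω (b i)).trans_eq ?_
    change 𝓝 (gnsExt ω (c • 1)) = _
    rw [gnsExt_smul, IsState.gnsExt_one hω.1, mul_one]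
  simpa only [hc, smul_apply, one_apply_eq_self, inner_smul_right] using hT x y

lemma IsFactorState.tendsto_apply_mul (hω : IsFactorState ω) (hb : IsAsymptoticallyCentral b l)
    {C : ℝ} (hC : ∀ i, ‖b i‖ ≤ C) {m : ℂ} (hm : Tendsto (fun i => ω (b i)) l (𝓝 m)) (a : A) :
    Tendsto (fun i => ω (a * b i)) l (𝓝 (ω a * m)) := by
  have h := hω.tendsto_inner hb hC hm (gnsClass ω (star a)) (gnsVector ω)
  simp only [← gnsClass_apply, inner_gnsClass, star_star] at h
  rwa [← gnsClass_one, inner_gnsClass, star_star, mul_one, mul_comm] at h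

variable [l.NeBot] {γ : ι → A ≃⋆ₐ[ℂ] A}

lemma IsFactorState.eq_of_dominated (hω : IsFactorState ω)
    (hγ : ∀ a, IsAsymptoticallyCentral (fun i => γ i a) l) (hω_inv : ∀ i a, ω (γ i a) = ω a)
    (hφ : IsState φ) (hφ_inv : ∀ i a, φ (γ i a) = φ a) {C : ℝ}
    (h : ∀ a, (φ (star a * a)).re ≤ C * (ω (star a * a)).re) : φ = ω := by
  obtain ⟨ξ, hξ⟩ := exists_eq_inner_of_dominated h
  refine PositiveLinearMap.ext fun a => ?_
  have hlim := hω.tendsto_inner (hγ a) (C := ‖a‖)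
    (fun i => (NonUnitalStarAlgHom.norm_map (γ i) (γ i).injective a).le)
    (tendsto_const_nhds.congr fun i => (hω_inv i a).symm) ξ (gnsVector ω)
  simp only [← gnsClass_apply, ← hξ, hφ_inv] at hlim
  rw [← gnsClass_one, ← hξ, hφ, mul_one] at hlim
  exact tendsto_nhds_unique tendsto_const_nhds hlim

lemma IsFactorState.isExtremalIn_invariant_states (hω : IsFactorState ω)
    (hγ : ∀ a, IsAsymptoticallyCentral (fun i => γ i a) l) (hω_inv : ∀ i a, ω (γ i a) = ω a) :
    IsExtremalIn {φ | IsState φ ∧ ∀ i a, φ (γ i a) = φ a} ω := by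
  refine ⟨⟨hω.1, hω_inv⟩, fun φ hφ ψ hψ s hs hs' h => ?_⟩
  have hre : ∀ (χ : A →ₚ[ℂ] ℂ) a, 0 ≤ (χ (star a * a)).re := fun χ a =>
    (Complex.nonneg_iff.1 (χ.map_nonneg (star_mul_self_nonneg a))).1
  have h' : ∀ a, (ω (star a * a)).re =
      s * (φ (star a * a)).re + (1 - s) * (ψ (star a * a)).re := fun a => by
    rw [h, Complex.add_re, Complex.re_ofReal_mul, Complex.re_ofReal_mul]
  have hs_sub : 0 < 1 - s := sub_pos.2 hs'
  constructor
  · refine hω.eq_of_dominated hγ hω_inv hφ.1 hφ.2 (C := s⁻¹) fun a => ?_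
    rw [h', le_inv_mul_iff₀ hs]
    exact le_add_of_nonneg_right (mul_nonneg hs_sub.le (hre ψ a))
  · refine hω.eq_of_dominated hγ hω_inv hψ.1 hψ.2 (C := (1 - s)⁻¹) fun a => ?_
    rw [h', le_inv_mul_iff₀ hs_sub]
    exact le_add_of_nonneg_left (mul_nonneg hs.le (hre φ a))

end AsymptoticallyCentral

section AsymptoticallyOrthogonal

open scoped NNReal

variable {𝕜 H X ι : Type*} [RCLike 𝕜] [NormedAddCommGroup H] [InnerProductSpace 𝕜 H]
  [MeasurableSpace X] {μ : Measure X} {l : Filter ι} {u : ι → X → H} {C : ℝ≥0}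

lemma integrable_inner_of_norm_le {h w : X → H} (hh : Integrable h μ)
    (hw : AEStronglyMeasurable w μ) (hC : ∀ x, ‖w x‖ ≤ C) :
    Integrable (fun x => ⟪h x, w x⟫_𝕜) μ := by
  refine (hh.norm.mul_const C).mono' (hh.aestronglyMeasurable.inner hw) (.of_forall fun x => ?_)
  exact (norm_inner_le_norm _ _).trans (by gcongr; exact hC x)

lemma norm_integral_inner_le {h w : X → H} (hh : Integrable h μ) (hC : ∀ x, ‖w x‖ ≤ C) :
    ‖∫ x, ⟪h x, w x⟫_𝕜 ∂μ‖ ≤ C * ∫ x, ‖h x‖ ∂μ := by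
  rw [← integral_const_mul]
  refine norm_integral_le_of_norm_le (hh.norm.const_mul _) (.of_forall fun x => ?_)
  rw [mul_comm]
  exact (norm_inner_le_norm _ _).trans (by gcongr; exact hC x)

lemma lipschitzWith_integral_inner {w : X → H} (hw : AEStronglyMeasurable w μ)
    (hC : ∀ x, ‖w x‖ ≤ C) :
    LipschitzWith C fun h : X →₁[μ] H => ∫ x, ⟪h x, w x⟫_𝕜 ∂μ := by
  refine LipschitzWith.of_dist_le_mul fun f g => ?_
  rw [dist_eq_norm, dist_eq_norm, L1.norm_eq_integral_norm,
    ← integral_sub (integrable_inner_of_norm_le (L1.integrable_coeFn f) hw hC)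
      (integrable_inner_of_norm_le (L1.integrable_coeFn g) hw hC)]
  simp only [← inner_sub_left]
  refine le_of_eq_of_le (congrArg _ (integral_congr_ae ?_))
    (norm_integral_inner_le (𝕜 := 𝕜) (L1.integrable_coeFn (f - g)) hC)
  filter_upwards [Lp.coeFn_sub f g] with x hx
  rw [hx, Pi.sub_apply]

variable [NormedSpace ℝ H] [CompleteSpace H] [l.IsCountablyGenerated]

lemma tendsto_integral_zero_of_tendsto_inner_zero [IsFiniteMeasure μ]
    (hu : ∀ i, AEStronglyMeasurable (u i) μ) (hC : ∀ i x, ‖u i x‖ ≤ C)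
    (horth : ∀ᵐ x ∂μ, ∀ᵐ y ∂μ, Tendsto (fun i => ⟪u i x, u i y⟫_𝕜) l (𝓝 0)) :
    Tendsto (fun i => ∫ x, u i x ∂μ) l (𝓝 0) := by
  have hint : ∀ i, Integrable (u i) μ := fun i =>
    Integrable.of_bound (hu i) C (.of_forall (hC i))
  have hweak : ∀ᵐ x ∂μ, Tendsto (fun i => ⟪u i x, ∫ y, u i y ∂μ⟫_𝕜) l (𝓝 0) := by
    filter_upwards [horth] with x hx
    simp only [← integral_inner (hint _)]
    rw [← integral_zero X 𝕜 (μ := μ)]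
    refine tendsto_integral_filter_of_dominated_convergence (fun _ => C * C)
      (.of_forall fun i => aestronglyMeasurable_const.inner (hu i))
      (.of_forall fun i => .of_forall fun y => (norm_inner_le_norm _ _).trans ?_)
      (integrable_const _) hx
    gcongr <;> exact hC _ _
  have hsq : Tendsto (fun i => ⟪∫ x, u i x ∂μ, ∫ y, u i y ∂μ⟫_𝕜) l (𝓝 0) := by
    simp only [← integral_inner (hint _)]
    rw [← integral_zero X 𝕜 (μ := μ)]
    refine tendsto_integral_filter_of_dominated_convergence
      (fun _ => C * μ.real Set.univ * C)
      (.of_forall fun i => aestronglyMeasurable_const.inner (hu i))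
      (.of_forall fun i => .of_forall fun x => (norm_inner_le_norm _ _).trans ?_)
      (integrable_const _) ?_
    · gcongr
      · exact norm_integral_le_of_norm_le_const (.of_forall (hC i))
      · exact hC _ _
    · filter_upwards [hweak] with x hx
      rw [tendsto_zero_iff_norm_tendsto_zero] at hx ⊢
      simpa only [norm_inner_symm] using hx
  rw [tendsto_zero_iff_norm_tendsto_zero] at hsq ⊢
  simpa only [inner_self_eq_norm_sq_to_K, norm_pow, RCLike.norm_ofReal, abs_norm,
    Real.sqrt_sq (norm_nonneg _), Real.sqrt_zero] using hsq.sqrt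

lemma tendsto_integral_inner_zero (hu : ∀ i, AEStronglyMeasurable (u i) μ)
    (hC : ∀ i x, ‖u i x‖ ≤ C)
    (horth : ∀ᵐ x ∂μ, ∀ᵐ y ∂μ, Tendsto (fun i => ⟪u i x, u i y⟫_𝕜) l (𝓝 0))
    {h : X → H} (hh : Integrable h μ) :
    Tendsto (fun i => ∫ x, ⟪h x, u i x⟫_𝕜 ∂μ) l (𝓝 0) := by
  refine Integrable.induction
    (fun h => Tendsto (fun i => ∫ x, ⟪h x, u i x⟫_𝕜 ∂μ) l (𝓝 0)) ?_ ?_ ?_ ?_ hh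
  · intro c s hs hfin
    have : IsFiniteMeasure (μ.restrict s) := ⟨by rwa [Measure.restrict_apply_univ]⟩
    have hindicator : ∀ i, ∫ x, ⟪s.indicator (fun _ => c) x, u i x⟫_𝕜 ∂μ =
        ⟪c, ∫ x in s, u i x ∂μ⟫_𝕜 := fun i => by
      rw [← integral_inner (Integrable.of_bound (hu i).restrict C (.of_forall (hC i))),
        ← integral_indicator hs]
      congr 1 with x
      by_cases hx : x ∈ s <;> simp [hx]
    simp only [hindicator]
    simpa only [inner_zero_right] using (tendsto_const_nhds (x := c)).inner (𝕜 := 𝕜)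
      (tendsto_integral_zero_of_tendsto_inner_zero (fun i => (hu i).restrict) hC
        (ae_restrict_of_ae (horth.mono fun _ => ae_restrict_of_ae)))
  · intro f g _ hf hg hf_lim hg_lim
    have hadd : ∀ i, ∫ x, ⟪(f + g) x, u i x⟫_𝕜 ∂μ =
        (∫ x, ⟪f x, u i x⟫_𝕜 ∂μ) + ∫ x, ⟪g x, u i x⟫_𝕜 ∂μ := fun i => by
      simp only [Pi.add_apply, inner_add_left]
      exact integral_add (integrable_inner_of_norm_le hf (hu i) (hC i))
        (integrable_inner_of_norm_le hg (hu i) (hC i))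
    simpa only [hadd, add_zero] using hf_lim.add hg_lim
  · exact (LipschitzWith.uniformEquicontinuous _ C fun i =>
      lipschitzWith_integral_inner (hu i) (hC i)).equicontinuous.isClosed_setOfPred_tendsto
        continuous_const
  · intro f g hfg _ hf_lim
    refine hf_lim.congr fun i => integral_congr_ae ?_
    filter_upwards [hfg] with x hx
    rw [hx]

end AsymptoticallyOrthogonal

section GNSAutomorphism

variable {A : Type*} [CStarAlgebra A] [PartialOrder A] [StarOrderedRing A] {ω : A →ₚ[ℂ] ℂ}

lemma eq_of_mem_commutant_gnsVN {S T : ω.GNS →L[ℂ] ω.GNS} (hS : S ∈ (gnsVN ω).commutant)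
    (hT : T ∈ (gnsVN ω).commutant)
    (h : ∀ a, gnsExt ω (ω.gnsStarAlgHom a * S) = gnsExt ω (ω.gnsStarAlgHom a * T)) : S = T := by
  have hinner : ∀ {R : ω.GNS →L[ℂ] ω.GNS}, R ∈ (gnsVN ω).commutant → ∀ a b,
      ⟪gnsClass ω a, R (gnsClass ω b)⟫_ℂ = gnsExt ω (ω.gnsStarAlgHom (star a * b) * R) :=
    fun {R} hR a b => by
      rw [inner_map_gnsClass hR, ← (mem_commutant_gnsVN_iff.1 hR _).eq, gnsExt, mul_apply_eq_comp,
        gnsClass_apply]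
  exact gns_ext_inner fun a b => by rw [hinner hS, hinner hT, h]

lemma gnsUnitary_gnsVector (γ : A ≃⋆ₐ[ℂ] A) (h : ∀ a, ω (γ a) = ω a) :
    (gnsUnitary ω γ h : ω.GNS →L[ℂ] ω.GNS) (gnsVector ω) = gnsVector ω := by
  rw [gnsVector, gnsUnitary_apply_coe, PositiveLinearMap.ofPreGNS_toPreGNS, map_one]

lemma gnsExt_gnsAut (γ : A ≃⋆ₐ[ℂ] A) (h : ∀ a, ω (γ a) = ω a) (T : ω.GNS →L[ℂ] ω.GNS) :
    gnsExt ω (gnsAut ω γ h T) = gnsExt ω T := by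
  set U := gnsUnitary ω γ h
  have hU : star (U : ω.GNS →L[ℂ] ω.GNS) (gnsVector ω) = gnsVector ω := by
    nth_rewrite 1 [← gnsUnitary_gnsVector γ h]
    rw [← mul_apply_eq_comp, Unitary.star_mul_self_of_mem U.2, one_apply_eq_self]
  calc gnsExt ω (gnsAut ω γ h T)
      = ⟪gnsVector ω, (U : ω.GNS →L[ℂ] ω.GNS) (T (gnsVector ω))⟫_ℂ := by
        rw [gnsAut, Unitary.conjStarAlgAut_apply, gnsExt, mul_apply_eq_comp, mul_apply_eq_comp, hU]
    _ = ⟪(U : ω.GNS →L[ℂ] ω.GNS) (gnsVector ω), (U : ω.GNS →L[ℂ] ω.GNS) (T (gnsVector ω))⟫_ℂ := by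
        rw [gnsUnitary_gnsVector]
    _ = gnsExt ω T := ContinuousLinearMap.inner_map_map_of_mem_unitary U.2 _ _

lemma gnsExt_gnsStarAlgHom_mul_gnsAut (γ : A ≃⋆ₐ[ℂ] A) (h : ∀ a, ω (γ a) = ω a) (a : A)
    (T : ω.GNS →L[ℂ] ω.GNS) :
    gnsExt ω (ω.gnsStarAlgHom (γ a) * gnsAut ω γ h T) = gnsExt ω (ω.gnsStarAlgHom a * T) := by
  rw [← gnsAut_gnsStarAlgHom ω γ h, ← map_mul, gnsExt_gnsAut]

lemma gnsAut_mem_commutant_gnsVN (γ : A ≃⋆ₐ[ℂ] A) (h : ∀ a, ω (γ a) = ω a)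
    {T : ω.GNS →L[ℂ] ω.GNS} (hT : T ∈ (gnsVN ω).commutant) :
    gnsAut ω γ h T ∈ (gnsVN ω).commutant := by
  refine mem_commutant_gnsVN_iff.2 fun a => ?_
  rw [← γ.apply_symm_apply a, ← gnsAut_gnsStarAlgHom ω γ h]
  exact (mem_commutant_gnsVN_iff.1 hT _).map (gnsAut ω γ h)

lemma gnsAut_eq_self {γ : A ≃⋆ₐ[ℂ] A} (h : ∀ a, ω (γ a) = ω a) {T : ω.GNS →L[ℂ] ω.GNS}
    (hT : T ∈ (gnsVN ω).commutant)
    (hγ : ∀ a, gnsExt ω (ω.gnsStarAlgHom (γ a) * T) = gnsExt ω (ω.gnsStarAlgHom a * T)) :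
    gnsAut ω γ h T = T := by
  refine eq_of_mem_commutant_gnsVN (gnsAut_mem_commutant_gnsVN γ h hT) hT fun a => ?_
  rw [← γ.apply_symm_apply a, gnsExt_gnsStarAlgHom_mul_gnsAut, hγ]

variable {ι : Type*} {l : Filter ι}

lemma exists_mem_gnsCenter_of_tendsto_apply_mul [l.NeBot] {b : ι → A}
    (hb : IsAsymptoticallyCentral b l) {C : ℝ} (hC : ∀ i, ‖b i‖ ≤ C) {F : A → ℂ}
    (hF : ∀ a, Tendsto (fun i => ω (a * b i)) l (𝓝 (F a))) :
    ∃ T ∈ gnsCenter ω, ∀ a, gnsExt ω (ω.gnsStarAlgHom a * T) = F a := by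
  set U := Ultrafilter.of l
  have hU : (U : Filter ι) ≤ l := Ultrafilter.of_le l
  obtain ⟨T, hT⟩ := exists_tendsto_inner_of_norm_le U fun i =>
    (norm_gnsStarAlgHom_le ω (b i)).trans (hC i)
  refine ⟨T, (hb.mono hU).mem_gnsCenter_of_tendsto hT, fun a => ?_⟩
  rw [gnsExt_gnsStarAlgHom_mul]
  refine tendsto_nhds_unique (hT _ _) (((hF a).mono_left hU).congr fun i => ?_)
  rw [← gnsClass_apply, inner_gnsClass, star_star]

lemma tendsto_gnsExt_mul_gnsAut_sub {γ : ι → A ≃⋆ₐ[ℂ] A} (h : ∀ i a, ω (γ i a) = ω a)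
    {T : ω.GNS →L[ℂ] ω.GNS} (hT : ∀ i, gnsAut ω (γ i) (h i) T = T) {a b : A}
    (hlim : Tendsto (fun i => ω (a * γ i b)) l (𝓝 (gnsExt ω (ω.gnsStarAlgHom a * T)))) :
    Tendsto (fun i => gnsExt ω (ω.gnsStarAlgHom a * gnsAut ω (γ i) (h i) (ω.gnsStarAlgHom b - T)))
      l (𝓝 0) := by
  rw [← sub_self (gnsExt ω (ω.gnsStarAlgHom a * T))]
  refine (hlim.sub_const _).congr fun i => ?_
  rw [map_sub, hT, gnsAut_gnsStarAlgHom, gnsExt_gnsStarAlgHom_mul, gnsExt_gnsStarAlgHom_mul,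
    sub_apply, inner_sub_right, ← gnsClass_apply, inner_gnsClass, star_star]

end GNSAutomorphism

section TruncatedCorrelation

variable {A : Type*} [CStarAlgebra A] [PartialOrder A] [StarOrderedRing A] {ω : A →ₚ[ℂ] ℂ}

/-- The truncated two-point function `ω(a* b) - ω(a)* ω(b)`, which is the inner product of the
components of `π_ω(a) Ω` and `π_ω(b) Ω` orthogonal to `Ω`. -/
noncomputable def truncatedCorrelation (ω : A →ₚ[ℂ] ℂ) (a b : A) : ℂ :=
  ω (star a * b) - star (ω a) * ω b

lemma continuous_gnsClass (ω : A →ₚ[ℂ] ℂ) : Continuous (gnsClass ω) :=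
  (map_continuous ω.gnsStarAlgHom).clm_apply continuous_const

lemma inner_gnsClass_sub_smul_one (a b : A) :
    ⟪gnsClass ω a, gnsClass ω (b - ω b • 1)⟫_ℂ = truncatedCorrelation ω a b := by
  rw [inner_gnsClass, mul_sub, mul_smul_comm, mul_one, map_sub, map_smul, map_star, smul_eq_mul,
    truncatedCorrelation, mul_comm (ω b)]

lemma IsState.inner_gnsClass_sub_smul_one_sub_smul_one (hω : IsState ω) (a b : A) :
    ⟪gnsClass ω (a - ω a • 1), gnsClass ω (b - ω b • 1)⟫_ℂ = truncatedCorrelation ω a b := by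
  have hone : ⟪gnsClass ω 1, gnsClass ω (b - ω b • 1)⟫_ℂ = 0 := by
    rw [gnsClass_one, inner_gnsVector_gnsClass, map_sub, map_smul, hω, smul_eq_mul, mul_one,
      sub_self]
  rw [map_sub (gnsClass ω) a, map_smul, inner_sub_left, inner_smul_left, hone, mul_zero, sub_zero,
    inner_gnsClass_sub_smul_one]

lemma IsState.norm_gnsClass_sub_smul_one_le (hω : IsState ω) (a : A) :
    ‖gnsClass ω (a - ω a • 1)‖ ≤ 2 * ‖a‖ := by
  rw [map_sub, map_smul, gnsClass_one, two_mul]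
  refine (norm_sub_le _ _).trans (add_le_add (hω.norm_gnsClass_le a) ?_)
  rw [norm_smul, hω.norm_gnsVector, mul_one]
  exact hω.norm_apply_le a

open scoped NNReal in
lemma IsState.tendsto_integral_truncatedCorrelation (hω : IsState ω) {X ι : Type*}
    [MeasurableSpace X] {μ : Measure X} {l : Filter ι} [l.IsCountablyGenerated]
    {b : ι → X → A} {C : ℝ≥0} (hb : ∀ i, AEStronglyMeasurable (b i) μ) (hC : ∀ i x, ‖b i x‖ ≤ C)
    (hdecor : ∀ᵐ x ∂μ, ∀ᵐ y ∂μ,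
      Tendsto (fun i => truncatedCorrelation ω (b i x) (b i y)) l (𝓝 0))
    {a : X → A} (ha : Integrable a μ) :
    Tendsto (fun i => ∫ x, truncatedCorrelation ω (a x) (b i x) ∂μ) l (𝓝 0) := by
  simp only [← inner_gnsClass_sub_smul_one]
  have hint : Integrable (fun x => gnsClass ω (a x)) μ :=
    ha.mono ((continuous_gnsClass ω).comp_aestronglyMeasurable ha.aestronglyMeasurable)
      (.of_forall fun x => hω.norm_gnsClass_le (a x))
  refine tendsto_integral_inner_zero (C := 2 * C) (fun i => ?_) (fun i x => ?_) ?_ hint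
  · exact (continuous_gnsClass ω).comp_aestronglyMeasurable <| (hb i).sub <|
      ((map_continuous ω).comp_aestronglyMeasurable (hb i)).smul_const 1
  · refine (hω.norm_gnsClass_sub_smul_one_le _).trans ?_
    push_cast
    gcongr
    exact hC i x
  · simpa only [hω.inner_gnsClass_sub_smul_one_sub_smul_one] using hdecor

end TruncatedCorrelation

section Density

variable {ι : Type*} {l : Filter ι}

open scoped NNReal in
lemma tendsto_zero_of_dense {E E' : Type*} [SeminormedAddCommGroup E] [SeminormedAddCommGroup E']
    {F : ι → E →+ E'} {C : ℝ≥0} (hF : ∀ i x, ‖F i x‖ ≤ C * ‖x‖) {s : Set E} (hs : Dense s)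
    (h : ∀ x ∈ s, Tendsto (fun i => F i x) l (𝓝 0)) (x : E) :
    Tendsto (fun i => F i x) l (𝓝 0) := by
  have hequi : Equicontinuous fun i => ⇑(F i) :=
    (LipschitzWith.uniformEquicontinuous _ C fun i =>
      AddMonoidHomClass.lipschitz_of_bound_nnnorm (F i) C (hF i)).equicontinuous
  exact (hequi.isClosed_setOfPred_tendsto continuous_const).closure_subset_iff.2 h (hs x)

variable {A : Type*} [NormedRing A]

lemma norm_mul_sub_mul_le (a b : A) : ‖a * b - b * a‖ ≤ 2 * ‖a‖ * ‖b‖ :=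
  calc ‖a * b - b * a‖ ≤ ‖a * b‖ + ‖b * a‖ := norm_sub_le _ _
    _ ≤ ‖a‖ * ‖b‖ + ‖b‖ * ‖a‖ := add_le_add (norm_mul_le _ _) (norm_mul_le _ _)
    _ = 2 * ‖a‖ * ‖b‖ := by ring

lemma isAsymptoticallyCentral_of_dense {γ : ι → A →+ A} (hγ : ∀ i a, ‖γ i a‖ ≤ ‖a‖) {D : Set A}
    (hD : Dense D) (hcomm : ∀ a ∈ D, ∀ b ∈ D, ∀ᶠ i in l, Commute a (γ i b)) (b : A) :
    IsAsymptoticallyCentral (fun i => γ i b) l := by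
  have hleft : ∀ a ∈ D, ∀ b, Tendsto (fun i => a * γ i b - γ i b * a) l (𝓝 0) := fun a ha =>
    tendsto_zero_of_dense
      (F := fun i => (AddMonoidHom.mulLeft a - AddMonoidHom.mulRight a).comp (γ i))
      (C := 2 * ‖a‖₊)
      (fun i x => (norm_mul_sub_mul_le a (γ i x)).trans <|
        mul_le_mul_of_nonneg_left (hγ i x) (by positivity))
      hD fun x hx => tendsto_nhds_of_eventually_eq <|
        (hcomm a ha x hx).mono fun i hi => sub_eq_zero.2 hi
  refine tendsto_zero_of_dense
    (F := fun i => AddMonoidHom.mulRight (γ i b) - AddMonoidHom.mulLeft (γ i b))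
    (C := 2 * ‖b‖₊) (fun i x => (norm_mul_sub_mul_le x (γ i b)).trans ?_) hD
    fun a ha => hleft a ha b
  rw [NNReal.coe_mul, NNReal.coe_ofNat, coe_nnnorm, mul_right_comm]
  gcongr
  exact hγ i b

end Density

namespace Spacetime

variable {ν : ℕ} {ι : Type*} {l : Filter ι}

/-- The points `p i` recede to infinity in space-like directions, uniformly away from the light
cone. This is the mode of convergence under which local commutativity makes a bounded region
commute with the translates of another one. -/
def TendstoSpacelikeInfinity (p : ι → Spacetime ν) (l : Filter ι) : Prop :=
  Tendsto (fun i => ‖(p i).2‖ - |(p i).1|) l atTop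

lemma minkowskiSq_neg_iff {p : Spacetime ν} : minkowskiSq p < 0 ↔ |p.1| < ‖p.2‖ := by
  rw [minkowskiSq, sub_neg, sq_lt_sq, abs_norm]

lemma TendstoSpacelikeInfinity.eventually_spacelikeSeparated {p : ι → Spacetime ν}
    (hp : TendstoSpacelikeInfinity p l) {O₁ O₂ : Set (Spacetime ν)}
    (h₁ : Bornology.IsBounded O₁) (h₂ : Bornology.IsBounded O₂) :
    ∀ᶠ i in l, SpacelikeSeparated O₁
      ((translation (p i) : Spacetime ν ≃ᵃ[ℝ] Spacetime ν) '' O₂) := by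
  obtain ⟨R₁, hR₁⟩ := h₁.exists_norm_le
  obtain ⟨R₂, hR₂⟩ := h₂.exists_norm_le
  filter_upwards [hp.eventually_gt_atTop (2 * (R₁ + R₂))] with i hi
  rintro q₁ hq₁ _ ⟨q₂, hq₂, rfl⟩
  change minkowskiSq (q₁ - (p i + q₂)) < 0
  rw [sub_add_eq_sub_sub_swap, minkowskiSq_neg_iff]
  set d := q₁ - q₂
  have hd : ‖d‖ ≤ R₁ + R₂ := (norm_sub_le _ _).trans (add_le_add (hR₁ _ hq₁) (hR₂ _ hq₂))
  have htime : |d.1 - (p i).1| ≤ |d.1| + |(p i).1| := abs_sub _ _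
  have hspace : ‖(p i).2‖ - ‖d.2‖ ≤ ‖d.2 - (p i).2‖ := by
    rw [norm_sub_rev]
    exact norm_sub_norm_le _ _
  have hd₁ : |d.1| ≤ R₁ + R₂ := (norm_fst_le d).trans hd
  have hd₂ : ‖d.2‖ ≤ R₁ + R₂ := (norm_snd_le d).trans hd
  rw [Prod.fst_sub, Prod.snd_sub]
  linarith

lemma translation_add (p q : Spacetime ν) :
    (translation (p + q) : poincareGroup ν) = translation p * translation q :=
  Subtype.ext (AffineEquiv.ext fun r => add_assoc p q r)

lemma tendstoSpacelikeInfinity_space :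
    TendstoSpacelikeInfinity (fun x : EuclideanSpace ℝ (Fin ν) => ((0, x) : Spacetime ν))
      (cocompact (EuclideanSpace ℝ (Fin ν))) := by
  simpa only [TendstoSpacelikeInfinity, abs_zero, sub_zero] using tendsto_norm_cocompact_atTop

variable [NeZero ν]

lemma boost_mul_translation (v : ℝ) (p : Spacetime ν) :
    (boost v * translation p : poincareGroup ν) = translation (boostFun v p) * boost v :=
  Subtype.ext (AffineEquiv.ext fun q => (boostLin v).map_add p q)

lemma abs_cosh_sub_lt_abs_sinh_sub {v w : ℝ} (h : v ≠ w) :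
    |Real.cosh w - Real.cosh v| < |Real.sinh w - Real.sinh v| := by
  have hcosh : 1 < Real.cosh (w - v) := Real.one_lt_cosh.2 (sub_ne_zero.2 h.symm)
  rw [Real.cosh_sub] at hcosh
  refine sq_lt_sq.1 ?_
  linarith only [hcosh, Real.cosh_sq v, Real.cosh_sq w,
    sub_sq (Real.cosh w) (Real.cosh v), sub_sq (Real.sinh w) (Real.sinh v)]

lemma tendstoSpacelikeInfinity_boost_sub {v w : ℝ} (h : v ≠ w) :
    TendstoSpacelikeInfinity
      (fun t : ℝ => (boostFun w (t, 0) - boostFun v (t, 0) : Spacetime ν)) atTop := by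
  refine (tendsto_id.atTop_mul_const
    (sub_pos.2 (abs_cosh_sub_lt_abs_sinh_sub h))).congr' ?_
  filter_upwards [eventually_ge_atTop 0] with t ht
  have htime : (boostFun w (t, 0) - boostFun v (t, 0) : Spacetime ν).1 =
      t * (Real.cosh w - Real.cosh v) := by
    simp only [boostFun, Prod.fst_sub, PiLp.zero_apply]
    ring
  have hspace : (boostFun w (t, 0) - boostFun v (t, 0) : Spacetime ν).2 =
      (-(t * (Real.sinh w - Real.sinh v))) • e₁ := by
    simp only [boostFun, Prod.snd_sub, PiLp.zero_apply]
    module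
  have he₁ : ‖(e₁ : EuclideanSpace ℝ (Fin ν))‖ = 1 := by simp [e₁]
  rw [htime, hspace, norm_smul, he₁, mul_one, norm_neg, Real.norm_eq_abs, abs_mul, abs_mul,
    abs_of_nonneg ht, ← mul_sub, id]

end Spacetime

namespace HaagKastlerNet

open Spacetime

section Covariance

variable {ν : ℕ} {A : Type*} [CStarAlgebra A] (N : HaagKastlerNet ν A)

lemma norm_act (g : poincareGroup ν) (a : A) : ‖N.act g a‖ = ‖a‖ :=
  NonUnitalStarAlgHom.norm_map (N.act g) (N.act g).injective a

lemma ξ_add (p q : Spacetime ν) (a : A) : N.ξ (p + q) a = N.ξ p (N.ξ q a) := by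
  rw [ξ, translation_add, map_mul]
  rfl

lemma boostAut_ξ [NeZero ν] (v : ℝ) (p : Spacetime ν) (a : A) :
    N.boostAut v (N.ξ p a) = N.ξ (boostFun v p) (N.boostAut v a) := by
  have h := congrArg N.act (boost_mul_translation v p)
  rw [map_mul, map_mul] at h
  exact DFunLike.congr_fun h a

lemma ξ_mem_localAlg (p : Spacetime ν) {O : Set (Spacetime ν)} (hO : IsOpen O)
    (hb : Bornology.IsBounded O) {a : A} (ha : a ∈ N.localAlg O) :
    N.ξ p a ∈ N.localAlg ((translation p : Spacetime ν ≃ᵃ[ℝ] Spacetime ν) '' O) := by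
  rw [← SetLike.mem_coe, N.covariance _ _ hO hb]
  exact ⟨a, ha, rfl⟩

lemma isAsymptoticallyCentral_ξ {ι : Type*} {l : Filter ι} {p : ι → Spacetime ν}
    (hp : TendstoSpacelikeInfinity p l) (b : A) :
    IsAsymptoticallyCentral (fun i => N.ξ (p i) b) l := by
  refine isAsymptoticallyCentral_of_dense (γ := fun i => (N.ξ (p i) : A →+ A))
    (fun i a => (N.norm_act _ a).le) N.quasilocal ?_ b
  rintro a ⟨O₁, ho₁, hb₁, ha⟩ c ⟨O₂, ho₂, hb₂, hc⟩
  filter_upwards [hp.eventually_spacelikeSeparated hb₁ hb₂] with i hi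
  exact N.locality _ _ ho₁ hb₁ ((Homeomorph.addLeft (p i)).isOpenMap _ ho₂) (hb₂.vadd (p i)) hi
    _ ha _ (N.ξ_mem_localAlg (p i) ho₂ hb₂ hc)

end Covariance

end HaagKastlerNet

lemma isCountablyGenerated_cocompact {E : Type*} [SeminormedAddCommGroup E] [ProperSpace E] :
    (cocompact E).IsCountablyGenerated := by
  rw [← Metric.cobounded_eq_cocompact, ← comap_norm_atTop]
  infer_instance

namespace SmearingFunction

variable (f : SmearingFunction)

lemma continuous : Continuous f.toFun := f.smooth.continuous

lemma integrable_smul {E : Type*} [NormedAddCommGroup E] [NormedSpace ℂ E] {g : ℝ → E}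
    (hg : Continuous g) : Integrable fun v => (f.toFun v : ℂ) • g v := by
  have hsupp : HasCompactSupport fun v => (f.toFun v : ℂ) :=
    f.hasCompactSupport.comp_left (g := ((↑) : ℝ → ℂ)) Complex.ofReal_zero
  exact ((Complex.continuous_ofReal.comp f.continuous).smul hg).integrable_of_hasCompactSupport
    hsupp.smul_right

lemma integrable : Integrable f.toFun :=
  f.continuous.integrable_of_hasCompactSupport f.hasCompactSupport

lemma exists_ne_zero : ∃ v, f.toFun v ≠ 0 := by
  by_contra! hf
  simpa only [hf, integral_zero, zero_ne_one] using f.integral_eq_one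

lemma eq_zero_of_integral_mul_norm_sq_eq_zero {g : ℝ → ℂ} (hg : Continuous g)
    (h : ∫ v, f.toFun v * ‖g v‖ ^ 2 = 0) {v : ℝ} (hv : f.toFun v ≠ 0) : g v = 0 := by
  by_contra hgv
  exact (Continuous.integral_pos_of_hasCompactSupport_nonneg_nonzero
    (f.continuous.mul (hg.norm.pow 2)) f.hasCompactSupport.mul_right
    (fun w => mul_nonneg (f.nonneg w) (sq_nonneg _))
    (mul_ne_zero hv (pow_ne_zero 2 (norm_ne_zero_iff.2 hgv)))).ne' h

end SmearingFunction

namespace HaagKastlerNet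

open Spacetime

variable {ν : ℕ} {A : Type*} [CStarAlgebra A] [PartialOrder A] [StarOrderedRing A]
  {N : HaagKastlerNet ν A} {ω : A →ₚ[ℂ] ℂ} {ι : Type*} {l : Filter ι} {p : ι → Spacetime ν}

section Clustering

lemma tendsto_apply_mul_ξ (hω : IsFactorState ω) (hinv : N.IsTranslationInvariant ω)
    (hp : TendstoSpacelikeInfinity p l) (a b : A) :
    Tendsto (fun i => ω (a * N.ξ (p i) b)) l (𝓝 (ω a * ω b)) :=
  hω.tendsto_apply_mul (N.isAsymptoticallyCentral_ξ hp b) (fun _ => (N.norm_act _ b).le)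
    (by simpa only [hinv _ b] using tendsto_const_nhds) a

lemma isExtremalSpaceInvariant_of_isFactorState [NeZero ν] (hω : IsFactorState ω)
    (hinv : N.IsSpaceInvariant ω) : N.IsExtremalSpaceInvariant ω :=
  hω.isExtremalIn_invariant_states (N.isAsymptoticallyCentral_ξ tendstoSpacelikeInfinity_space) hinv

end Clustering

variable [NeZero ν]

section Boosted

lemma boosted_apply (N : HaagKastlerNet ν A) (ω : A →ₚ[ℂ] ℂ) (v : ℝ) (a : A) :
    N.boosted ω v a = ω (N.boostAut v a) := rfl

lemma isState_boosted (hω : IsState ω) (v : ℝ) : IsState (N.boosted ω v) := by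
  rw [IsState, boosted_apply, map_one, hω]

lemma IsTranslationInvariant.boosted (hinv : N.IsTranslationInvariant ω) (v : ℝ) :
    N.IsTranslationInvariant (N.boosted ω v) := fun p a => by
  rw [boosted_apply, boosted_apply, boostAut_ξ, hinv]

lemma continuous_boosted (h : N.ContinuousBoosts) (ω : A →ₚ[ℂ] ℂ) (a : A) :
    Continuous fun v => N.boosted ω v a :=
  (map_continuous ω).comp (h.continuous a)

lemma boosted_zero (N : HaagKastlerNet ν A) (ω : A →ₚ[ℂ] ℂ) : N.boosted ω 0 = ω := by
  ext a
  rw [boosted_apply, boostAut, boost_zero, map_one]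
  rfl

lemma boosted_add (N : HaagKastlerNet ν A) (ω : A →ₚ[ℂ] ℂ) (v w : ℝ) :
    N.boosted ω (v + w) = N.boosted (N.boosted ω v) w := by
  ext a
  rw [boosted_apply, boosted_apply, boosted_apply, boostAut_add]

/-- The group of rapidities `v` such that `ω_v = ω`; boost invariance of `ω` is proved by showing
that this subgroup of `ℝ` is open. -/
def boostStabilizer (N : HaagKastlerNet ν A) (ω : A →ₚ[ℂ] ℂ) : AddSubgroup ℝ where
  carrier := {v | N.boosted ω v = ω}
  add_mem' {v w} (hv : N.boosted ω v = ω) (hw : N.boosted ω w = ω) :=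
    (boosted_add N ω v w).trans (hv.symm ▸ hw)
  zero_mem' := boosted_zero N ω
  neg_mem' {v} (hv : N.boosted ω v = ω) := by
    change N.boosted ω (-v) = ω
    nth_rewrite 1 [← hv]
    rw [← boosted_add, add_neg_cancel, boosted_zero]

lemma mem_boostStabilizer {v : ℝ} : v ∈ N.boostStabilizer ω ↔ N.boosted ω v = ω := Iff.rfl

lemma sub_mem_boostStabilizer {v w : ℝ} (h : N.boosted ω v = N.boosted ω w) :
    v - w ∈ N.boostStabilizer ω := by
  rw [mem_boostStabilizer, sub_eq_add_neg, boosted_add, h, ← boosted_add, add_neg_cancel,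
    boosted_zero]

lemma boosted_eq_of_eqOn_open {s : Set ℝ} (hs : IsOpen s) (hne : s.Nonempty)
    {φ : A →ₚ[ℂ] ℂ} (hφ : ∀ v ∈ s, N.boosted ω v = φ) (v : ℝ) : N.boosted ω v = ω := by
  obtain ⟨v₀, hv₀⟩ := hne
  have hsub : (fun v => v - v₀) '' s ⊆ N.boostStabilizer ω := by
    rintro _ ⟨v, hv, rfl⟩
    exact sub_mem_boostStabilizer ((hφ v hv).trans (hφ v₀ hv₀).symm)
  have hopen : IsOpen (N.boostStabilizer ω : Set ℝ) :=
    (N.boostStabilizer ω).isOpen_of_mem_nhds <| mem_of_superset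
      (((Homeomorph.subRight v₀).isOpenMap s hs).mem_nhds ⟨v₀, hv₀, rfl⟩) hsub
  have huniv : (N.boostStabilizer ω : Set ℝ) = Set.univ :=
    IsClopen.eq_univ ⟨AddSubgroup.isClosed_of_isOpen _ hopen, hopen⟩ ⟨0, zero_mem _⟩
  exact mem_boostStabilizer.1 (huniv.ge (Set.mem_univ v))

end Boosted

section Smeared

variable (h : N.ContinuousBoosts) (f : SmearingFunction)

lemma smeared_apply (ω : A →ₚ[ℂ] ℂ) (a : A) :
    N.smeared h ω f a = ∫ v, (f.toFun v : ℂ) * N.boosted ω v a := rfl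

lemma isState_smeared (hω : IsState ω) : IsState (N.smeared h ω f) := by
  have hone : ∀ v, N.boosted ω v 1 = 1 := isState_boosted hω
  simp only [IsState, smeared_apply, hone, mul_one, integral_complex_ofReal, f.integral_eq_one,
    Complex.ofReal_one]

lemma isTranslationInvariant_smeared (hinv : N.IsTranslationInvariant ω) :
    N.IsTranslationInvariant (N.smeared h ω f) := fun p a => by
  simp only [smeared_apply, hinv.boosted _ p a]

/-- The form `(a, b) ↦ ∫ f(v) ω_v(a) ω_v(b) dv`, the common limit of the correlations
`ω_f(a σ_x(b))` and `ω_f(a τ_t(b))` of a smeared factor state at large separation. -/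
noncomputable def smearedProduct (N : HaagKastlerNet ν A) (ω : A →ₚ[ℂ] ℂ) (f : SmearingFunction)
    (a b : A) : ℂ :=
  ∫ v, (f.toFun v : ℂ) * (N.boosted ω v a * N.boosted ω v b)

lemma smearedProduct_ξ_left (hinv : N.IsTranslationInvariant ω) (q : Spacetime ν) (a b : A) :
    N.smearedProduct ω f (N.ξ q a) b = N.smearedProduct ω f a b := by
  simp only [smearedProduct, hinv.boosted _ q a]

lemma tendsto_smeared_mul_ξ [l.IsCountablyGenerated] (hω : IsFactorState ω)
    (hinv : N.IsTranslationInvariant ω) (hp : TendstoSpacelikeInfinity p l) (a b : A) :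
    Tendsto (fun i => N.smeared h ω f (a * N.ξ (p i) b)) l (𝓝 (N.smearedProduct ω f a b)) := by
  simp only [smeared_apply]
  refine tendsto_integral_filter_of_dominated_convergence (fun v => f.toFun v * (‖a‖ * ‖b‖))
    (.of_forall fun i => (integrable_smear h ω f _).aestronglyMeasurable)
    (.of_forall fun i => .of_forall fun v => ?_) (f.integrable.mul_const _)
    (.of_forall fun v =>
      (tendsto_apply_mul_ξ (hω.pullback _) (hinv.boosted v) hp a b).const_mul _)
  rw [norm_mul, Complex.norm_real, Real.norm_of_nonneg (f.nonneg v)]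
  refine mul_le_mul_of_nonneg_left ?_ (f.nonneg v)
  calc ‖N.boosted ω v (a * N.ξ (p i) b)‖ ≤ ‖a * N.ξ (p i) b‖ :=
        (isState_boosted hω.1 v).norm_apply_le _
    _ ≤ ‖a‖ * ‖N.ξ (p i) b‖ := norm_mul_le _ _
    _ = ‖a‖ * ‖b‖ := by rw [ξ, N.norm_act]

-- In the common rest frame, `ω_v` and `ω_w` see `b` translated along two different time-like
-- directions, which separate in a space-like way.
lemma tendsto_truncatedCorrelation_boosted_time (hω : IsFactorState ω)
    (hinv : N.IsTranslationInvariant ω) (b : A) {v w : ℝ} (hvw : v ≠ w) :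
    Tendsto (fun t => truncatedCorrelation ω (N.boostAut v (N.τ t b)) (N.boostAut w (N.τ t b)))
      atTop (𝓝 0) := by
  have hlim := (tendsto_apply_mul_ξ hω hinv (tendstoSpacelikeInfinity_boost_sub hvw)
    (star (N.boostAut v b)) (N.boostAut w b)).sub_const
      (star (ω (N.boostAut v b)) * ω (N.boostAut w b))
  rw [map_star, sub_self] at hlim
  refine hlim.congr fun t => ?_
  have hstar : star (N.ξ (boostFun v (t, 0)) (N.boostAut v b)) =
      N.ξ (boostFun v (t, 0)) (star (N.boostAut v b)) := (map_star (N.ξ _) _).symm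
  rw [truncatedCorrelation, τ, boostAut_ξ, boostAut_ξ, hinv, hinv, hstar,
    ← hinv (boostFun v (t, 0)), map_mul, ← ξ_add, add_sub_cancel]

lemma integral_truncatedCorrelation_smul (hinv : N.IsTranslationInvariant ω) (a b : A)
    (q : Spacetime ν) :
    ∫ v, truncatedCorrelation ω ((f.toFun v : ℂ) • N.boostAut v (star a))
        (N.boostAut v (N.ξ q b)) =
      N.smeared h ω f (a * N.ξ q b) - N.smearedProduct ω f a b := by
  have hprod : Continuous fun v => N.boosted ω v a * N.boosted ω v b :=
    (continuous_boosted h ω a).mul (continuous_boosted h ω b)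
  rw [smeared_apply, smearedProduct]
  refine Eq.trans ?_ (integral_sub (integrable_smear h ω f _) (f.integrable_smul hprod))
  refine integral_congr_ae (.of_forall fun v => ?_)
  have hb : ω (N.boostAut v (N.ξ q b)) = N.boosted ω v b := hinv.boosted v q b
  simp only [truncatedCorrelation, star_smul, map_smul, smul_eq_mul, map_star, star_star,
    smul_mul_assoc, star_mul', hb, boosted_apply, map_mul (N.boostAut v), Complex.star_def,
    Complex.conj_ofReal, starRingEnd_self_apply, mul_assoc]

lemma tendsto_smeared_mul_τ (hω : IsFactorState ω) (hinv : N.IsTranslationInvariant ω) (a b : A) :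
    Tendsto (fun t => N.smeared h ω f (a * N.τ t b)) atTop (𝓝 (N.smearedProduct ω f a b)) := by
  have hlim := hω.1.tendsto_integral_truncatedCorrelation (μ := volume) (l := atTop)
    (b := fun t v => N.boostAut v (N.τ t b)) (C := ‖b‖₊)
    (fun t => (h.continuous _).aestronglyMeasurable)
    (fun t v => by rw [boostAut, norm_act, τ, ξ, norm_act, coe_nnnorm])
    (.of_forall fun v => mem_of_superset (compl_mem_ae_iff.2 (measure_singleton v)) fun w hw =>
      tendsto_truncatedCorrelation_boosted_time hω hinv b (Ne.symm hw))
    (f.integrable_smul (h.continuous (star a)))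
  simp only [τ, integral_truncatedCorrelation_smul h f hinv] at hlim
  exact tendsto_sub_nhds_zero_iff.1 hlim

lemma smearedProduct_eq_mul_of_isFactorState (hω : IsFactorState ω)
    (hinv : N.IsTranslationInvariant ω) (hf : IsFactorState (N.smeared h ω f)) (a b : A) :
    N.smearedProduct ω f a b = N.smeared h ω f a * N.smeared h ω f b :=
  have := isCountablyGenerated_cocompact (E := EuclideanSpace ℝ (Fin ν))
  tendsto_nhds_unique (tendsto_smeared_mul_ξ h f hω hinv tendstoSpacelikeInfinity_space a b)
    (tendsto_apply_mul_ξ hf (isTranslationInvariant_smeared h f hinv)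
      tendstoSpacelikeInfinity_space a b)

-- With `c = b - ω_f(b)`, the product formula gives `∫ f(v) |ω_v(c)|² dv = |ω_f(c)|² = 0`.
lemma boosted_eq_smeared_of_smearedProduct_eq_mul (hω : IsState ω)
    (hmul : ∀ a b, N.smearedProduct ω f a b = N.smeared h ω f a * N.smeared h ω f b) {v : ℝ}
    (hv : f.toFun v ≠ 0) : N.boosted ω v = N.smeared h ω f := by
  ext b
  set c : A := b - N.smeared h ω f b • 1 with hc
  have hsmeared : N.smeared h ω f c = 0 := by
    rw [map_sub, map_smul, isState_smeared h f hω, smul_eq_mul, mul_one, sub_self]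
  have hvariance : ∫ w, f.toFun w * ‖N.boosted ω w c‖ ^ 2 = 0 := by
    rw [← Complex.ofReal_inj, ← integral_complex_ofReal, Complex.ofReal_zero,
      ← mul_zero (N.smeared h ω f (star c)), ← hsmeared, ← hmul, smearedProduct]
    refine integral_congr_ae (.of_forall fun w => ?_)
    simp only [map_star, Complex.ofReal_mul, Complex.ofReal_pow, ← Complex.conj_mul',
      Complex.star_def]
  have hzero := f.eq_zero_of_integral_mul_norm_sq_eq_zero (continuous_boosted h ω c) hvariance hv
  rwa [hc, map_sub, map_smul, isState_boosted hω v, smul_eq_mul, mul_one, sub_eq_zero] at hzero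

lemma boosted_eq_of_isFactorState_smeared (hω : IsFactorState ω)
    (hinv : N.IsTranslationInvariant ω) (hf : IsFactorState (N.smeared h ω f)) (v : ℝ) :
    N.boosted ω v = ω :=
  boosted_eq_of_eqOn_open (isOpen_ne.preimage f.continuous) f.exists_ne_zero
    (fun _ hv => boosted_eq_smeared_of_smearedProduct_eq_mul h f hω.1
      (smearedProduct_eq_mul_of_isFactorState h f hω hinv hf) hv) v

lemma exists_mem_gnsCenter_smeared (hω : IsFactorState ω) (hinv : N.IsTranslationInvariant ω)
    (b : A) :
    ∃ T ∈ gnsCenter (N.smeared h ω f),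
      (∀ q, gnsAut _ (N.ξ q) (isTranslationInvariant_smeared h f hinv q) T = T) ∧
      ∀ a, gnsExt (N.smeared h ω f) ((N.smeared h ω f).gnsStarAlgHom a * T) =
        N.smearedProduct ω f a b := by
  have := isCountablyGenerated_cocompact (E := EuclideanSpace ℝ (Fin ν))
  obtain ⟨T, hT, hprod⟩ := exists_mem_gnsCenter_of_tendsto_apply_mul
    (N.isAsymptoticallyCentral_ξ tendstoSpacelikeInfinity_space b)
    (fun _ => (N.norm_act _ b).le)
    fun a => tendsto_smeared_mul_ξ h f hω hinv tendstoSpacelikeInfinity_space a b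
  refine ⟨T, hT, fun q => gnsAut_eq_self _ hT.2 fun a => ?_, hprod⟩
  rw [hprod, hprod, smearedProduct_ξ_left f hinv]

end Smeared

end HaagKastlerNet

theorem theorem1_general {ν : ℕ} [NeZero ν] {A : Type*} [CStarAlgebra A] [PartialOrder A]
    [StarOrderedRing A] (N : HaagKastlerNet ν A) (hboost : N.ContinuousBoosts)
    (ω : A →ₚ[ℂ] ℂ) (hω : IsFactorState ω) (hinv : N.IsTranslationInvariant ω) :
    (∀ v : ℝ, N.IsExtremalSpaceInvariant (N.boosted ω v) ∧
      N.IsTimeInvariant (N.boosted ω v) ∧ IsFactorState (N.boosted ω v)) ∧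
    ∀ f : SmearingFunction,
      IsState (N.smeared hboost ω f) ∧
      ((∃ v : ℝ, N.boosted ω v ≠ ω) → ¬ IsFactorState (N.smeared hboost ω f)) ∧
      ∃ hf : N.IsTranslationInvariant (N.smeared hboost ω f),
        ∀ B : A, ∃ Bf ∈ gnsCenter (N.smeared hboost ω f),
          (∀ x, N.σExt hf x Bf = Bf) ∧ (∀ t, N.τExt hf t Bf = Bf) ∧
          (∀ a : A,
            gnsExt (N.smeared hboost ω f) ((N.smeared hboost ω f).gnsStarAlgHom a * Bf) =
              gnsExt (N.smeared hboost ω f) (Bf * (N.smeared hboost ω f).gnsStarAlgHom a)) ∧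
          (∀ a : A, Tendsto (fun x : EuclideanSpace ℝ (Fin ν) =>
            gnsExt (N.smeared hboost ω f) ((N.smeared hboost ω f).gnsStarAlgHom a *
              N.σExt hf x ((N.smeared hboost ω f).gnsStarAlgHom B - Bf)))
            (cocompact (EuclideanSpace ℝ (Fin ν))) (𝓝 0)) ∧
          (∀ a : A, Tendsto (fun t : ℝ =>
            gnsExt (N.smeared hboost ω f) ((N.smeared hboost ω f).gnsStarAlgHom a *
              N.τExt hf t ((N.smeared hboost ω f).gnsStarAlgHom B - Bf)))
            atTop (𝓝 0)) := by
  have := isCountablyGenerated_cocompact (E := EuclideanSpace ℝ (Fin ν))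
  refine ⟨fun v => ?_, fun f => ?_⟩
  · have hfactor : IsFactorState (N.boosted ω v) := hω.pullback _
    have hinv_v : N.IsTranslationInvariant (N.boosted ω v) := hinv.boosted v
    exact ⟨HaagKastlerNet.isExtremalSpaceInvariant_of_isFactorState hfactor
      fun x => hinv_v (0, x), fun t => hinv_v (t, 0), hfactor⟩
  · have hf := HaagKastlerNet.isTranslationInvariant_smeared hboost f hinv
    refine ⟨HaagKastlerNet.isState_smeared hboost f hω.1, fun ⟨v, hv⟩ hfactor => hv <|
      HaagKastlerNet.boosted_eq_of_isFactorState_smeared hboost f hω hinv hfactor v, hf,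
      fun B => ?_⟩
    obtain ⟨Bf, hmem, hfix, hprod⟩ :=
      HaagKastlerNet.exists_mem_gnsCenter_smeared hboost f hω hinv B
    refine ⟨Bf, hmem, fun x => hfix (0, x), fun t => hfix (t, 0), fun a => ?_, fun a => ?_,
      fun a => ?_⟩
    · rw [(mem_commutant_gnsVN_iff.1 hmem.2 a).eq]
    · refine tendsto_gnsExt_mul_gnsAut_sub (fun x => hf (0, x)) (fun x => hfix (0, x)) ?_
      rw [hprod]
      exact HaagKastlerNet.tendsto_smeared_mul_ξ hboost f hω hinv
        Spacetime.tendstoSpacelikeInfinity_space a B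
    · refine tendsto_gnsExt_mul_gnsAut_sub (fun t => hf (t, 0)) (fun t => hfix (t, 0)) ?_
      rw [hprod]
      exact HaagKastlerNet.tendsto_smeared_mul_τ hboost f hω hinv a B

theorem theorem1 {ν : ℕ} [NeZero ν] {A : Type*} [CStarAlgebra A] [PartialOrder A]
    [StarOrderedRing A] (N : HaagKastlerNet ν A)
    (hτσ : N.ContinuousTranslations) (hboost : N.ContinuousBoosts)
    (ω : A →ₚ[ℂ] ℂ) (hω : IsPureState ω ∨ IsFactorState ω)
    (hinv : N.IsTranslationInvariant ω) (hext : N.IsExtremalSpaceInvariant ω) :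
    (∀ v : ℝ, N.IsExtremalSpaceInvariant (N.boosted ω v) ∧
      N.IsTimeInvariant (N.boosted ω v) ∧ IsFactorState (N.boosted ω v)) ∧
    ∀ f : SmearingFunction,
      IsState (N.smeared hboost ω f) ∧
      ((∃ v : ℝ, N.boosted ω v ≠ ω) → ¬ IsFactorState (N.smeared hboost ω f)) ∧
      ∃ hf : N.IsTranslationInvariant (N.smeared hboost ω f),
        ∀ B : A, ∃ Bf ∈ gnsCenter (N.smeared hboost ω f),
          (∀ x, N.σExt hf x Bf = Bf) ∧ (∀ t, N.τExt hf t Bf = Bf) ∧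
          (∀ a : A,
            gnsExt (N.smeared hboost ω f) ((N.smeared hboost ω f).gnsStarAlgHom a * Bf) =
              gnsExt (N.smeared hboost ω f) (Bf * (N.smeared hboost ω f).gnsStarAlgHom a)) ∧
          (∀ a : A, Tendsto (fun x : EuclideanSpace ℝ (Fin ν) =>
            gnsExt (N.smeared hboost ω f) ((N.smeared hboost ω f).gnsStarAlgHom a *
              N.σExt hf x ((N.smeared hboost ω f).gnsStarAlgHom B - Bf)))
            (cocompact (EuclideanSpace ℝ (Fin ν))) (𝓝 0)) ∧
          (∀ a : A, Tendsto (fun t : ℝ =>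
            gnsExt (N.smeared hboost ω f) ((N.smeared hboost ω f).gnsStarAlgHom a *
              N.τExt hf t ((N.smeared hboost ω f).gnsStarAlgHom B - Bf)))
            atTop (𝓝 0)) :=
  theorem1_general N hboost ω (hω.elim IsPureState.isFactorState id) hinv
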